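/- Let $a<b$, $I=(a,b)$, let $k\ge 1$ be an integer, and let $a_2\in H^{k}(I)$, $a_0\in H^1(I)$ satisfy $a_2\ge a_{\min}>0$ and $a_0\ge 0$ on $I$. Then there is a constant $C>0$, depending only on $a,b,k,a_2,a_0$, such that the following holds. Let $f\in L_2(I)$ and let $u\in H^{k+1}(I)$ solve $$-(a_2u')'+a_0u=f\ \text{ in } I,\qquad u(a)=0,\quad u'(b)=0 .$$ Let $I_h: a=x_1<x_2<\dots<x_N=b$ ($N\ge 2$) be any partition with elements $I_i=(x_i,x_{i+1})$ and mesh size $h=\max_i (x_{i+1}-x_i)$. A discrete weak function $v\in W(I_h,k)$ consists, on each element $I_i$, of an interior polynomial $v^0\in P_k(I_i)$ and two endpoint values $v^i,v^{i+1}\in\mathbb R$ (not necessarily the traces of $v^0$); $S_h$ is the space of those $v\in W(I_h,k)$ whose two values at each interior node agree and for which $v^1=0$. With $r=k+1$, the discrete weak derivative $d_{w,r}v|_{I_i}\in P_r(I_i)$ is the unique solution of $$\int_{I_i} d_{w,r}v\,q\,dx=-\int_{I_i}v^0q'\,dx+v^{i+1}q(x_{i+1})-v^iq(x_i)\qquad\forall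 q\in P_r(I_i).$$ If $u_h\in S_h$ satisfies $$\sum_{i=1}^{N-1}\int_{I_i}a_2\,d_{w,r}u_h\,d_{w,r}v\,dx+\int_I a_0u_h^0v^0\,dx=\int_I f v^0\,dx\qquad\forall v\in S_h,$$ then $$\|u-u_h^0\|_{L_2(I)}\le C\,h^{k+1}\,\|u\|_{H^{k+1}(I)} .$$ -/

import Mathlib

open MeasureTheory Set Filter

noncomputable section

namespace WeakFEM

/-! ### Sobolev spaces on an interval -/

/-- `g` is the weak derivative of order `j` of `u` on the open interval `(a, b)`. -/
def HasWeakDeriv (a b : ℝ) (j : ℕ) (u g : ℝ → ℝ) : Prop :=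
  LocallyIntegrableOn u (Ioo a b) ∧ LocallyIntegrableOn g (Ioo a b) ∧
    ∀ φ : ℝ → ℝ, ContDiff ℝ ((⊤ : ℕ∞) : WithTop ℕ∞) φ → HasCompactSupport φ →
      tsupport φ ⊆ Ioo a b →
        ∫ x in a..b, u x * iteratedDeriv j φ x = (-1) ^ j * ∫ x in a..b, g x * φ x

/-- `u ∈ L_2(a, b)`. -/
def MemL2 (a b : ℝ) (u : ℝ → ℝ) : Prop :=
  MemLp u 2 (volume.restrict (Ioo a b))

/-- The norm of `L_2(a, b)`. -/
def normL2 (a b : ℝ) (u : ℝ → ℝ) : ℝ :=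
  Real.sqrt (∫ x in a..b, u x ^ 2)

/-- `u ∈ H^m(a, b)`: all weak derivatives of order at most `m` (order `0` is `u` itself) exist and
lie in `L_2(a, b)`. -/
def MemH (m : ℕ) (a b : ℝ) (u : ℝ → ℝ) : Prop :=
  ∀ j ≤ m, ∃ g : ℝ → ℝ, HasWeakDeriv a b j u g ∧ MemL2 a b g

open Classical in
/-- A representative of the weak derivative of order `j` (unique up to null sets); it is `0` when
there is no weak derivative. -/
def weakDeriv (a b : ℝ) (j : ℕ) (u : ℝ → ℝ) : ℝ → ℝ :=
  if h : ∃ g : ℝ → ℝ, HasWeakDeriv a b j u g then h.choose else 0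

/-- The norm of `H^m(a, b)`, for functions satisfying `MemH m a b`. -/
def normH (m : ℕ) (a b : ℝ) (u : ℝ → ℝ) : ℝ :=
  Real.sqrt (∑ j ∈ Finset.range (m + 1), normL2 a b (weakDeriv a b j u) ^ 2)

/-- The continuous representative of `u` on `[a, b]` exists and takes the value `c` at `x`. This is
the pointwise value (the trace, at an endpoint) of an `H^1` function. -/
def HasValueAt (a b : ℝ) (u : ℝ → ℝ) (x c : ℝ) : Prop :=
  ∃ v : ℝ → ℝ, ContinuousOn v (Icc a b) ∧ v =ᵐ[volume.restrict (Ioo a b)] u ∧ v x = c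

/-! ### The boundary value problem -/

/-- `u` solves `-(a₂ u')' + a₀ u = f` on `(a, b)`, `u(a) = 0`, `u'(b) = 0`; the derivatives are
weak derivatives. -/
def IsBVPSolution (a b : ℝ) (a₂ a₀ f u : ℝ → ℝ) : Prop :=
  ∃ u' : ℝ → ℝ, HasWeakDeriv a b 1 u u' ∧
    HasWeakDeriv a b 1 (fun x => a₂ x * u' x) (fun x => a₀ x * u x - f x) ∧
    HasValueAt a b u a 0 ∧ HasValueAt a b u' b 0

/-! ### Partitions and discrete weak functions -/

/-- A partition `a = x_0 < x_1 < ⋯ < x_{n+1} = b` with `n` interior nodes, `n + 1` elements. -/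
structure Partition (a b : ℝ) where
  n : ℕ
  node : Fin (n + 2) → ℝ
  strictMono : StrictMono node
  node_first : node 0 = a
  node_last : node (Fin.last (n + 1)) = b

namespace Partition

variable {a b : ℝ} (T : Partition a b)

/-- Left endpoint of the `i`-th element. -/
def lo (i : Fin (T.n + 1)) : ℝ := T.node i.castSucc

/-- Right endpoint of the `i`-th element. -/
def hi (i : Fin (T.n + 1)) : ℝ := T.node i.succ

theorem lo_lt_hi (i : Fin (T.n + 1)) : T.lo i < T.hi i :=
  T.strictMono Fin.castSucc_lt_succ

/-- The mesh size `h = max h_i`. -/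
def meshSize : ℝ :=
  Finset.univ.sup' Finset.univ_nonempty fun i : Fin (T.n + 1) => T.hi i - T.lo i

end Partition

/-- The space `W(I_h, k)`: on each element, a polynomial of degree at most `k` in the interior and
two independent values at the endpoints. -/
structure WeakFunction {a b : ℝ} (T : Partition a b) (k : ℕ) where
  interior : Fin (T.n + 1) → Polynomial ℝ
  natDegree_le : ∀ i, (interior i).natDegree ≤ k
  left : Fin (T.n + 1) → ℝ
  right : Fin (T.n + 1) → ℝ

/-- The equation defining the discrete weak derivative `d ∈ P_r(α, β)` of the weak function with
interior part `v` and endpoint values `vα`, `vβ`. -/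
def IsDiscreteWeakDeriv (r : ℕ) (α β : ℝ) (v : Polynomial ℝ) (vα vβ : ℝ) (d : Polynomial ℝ) :
    Prop :=
  d.natDegree ≤ r ∧ ∀ q : Polynomial ℝ, q.natDegree ≤ r →
    ∫ x in α..β, d.eval x * q.eval x =
      -(∫ x in α..β, v.eval x * q.derivative.eval x) + vβ * q.eval β - vα * q.eval α

theorem eq_zero_of_integral_sq {α β : ℝ} (h : α < β) (p : Polynomial ℝ)
    (hp : ∫ x in α..β, p.eval x * p.eval x = 0) : p = 0 := by
  by_contra hne
  have hfin : (p.rootSet ℝ).Finite := p.rootSet_finite ℝ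
  obtain ⟨c, hc, hcr⟩ := ((Icc_infinite h).sdiff hfin).nonempty
  have hc0 : p.eval c ≠ 0 := by
    intro h0
    apply hcr
    rw [Polynomial.mem_rootSet]
    exact ⟨hne, by simpa using h0⟩
  have hpos : 0 < ∫ x in α..β, p.eval x * p.eval x :=
    intervalIntegral.integral_pos h (by fun_prop) (fun x _ => mul_self_nonneg _)
      ⟨c, hc, mul_self_pos.mpr hc0⟩
  exact hpos.ne' hp

theorem existsUnique_discreteWeakDeriv (r : ℕ) {α β : ℝ} (h : α < β) (v : Polynomial ℝ)
    (vα vβ : ℝ) : ∃! d : Polynomial ℝ, IsDiscreteWeakDeriv r α β v vα vβ d := by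
  have hmem : ∀ p : Polynomial ℝ, p ∈ Polynomial.degreeLT ℝ (r + 1) ↔ p.natDegree ≤ r := by
    intro p
    rw [Polynomial.mem_degreeLT, Polynomial.degree_lt_iff_coeff_zero,
      Polynomial.natDegree_le_iff_coeff_eq_zero]
    rfl
  have hint : ∀ p q : Polynomial ℝ,
      IntervalIntegrable (fun x => p.eval x * q.eval x) volume α β := fun p q =>
    Continuous.intervalIntegrable (by fun_prop) _ _
  let V := Polynomial.degreeLT ℝ (r + 1)
  have : FiniteDimensional ℝ V :=
    Module.Finite.equiv (Polynomial.degreeLTEquiv ℝ (r + 1)).symm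
  let B : V →ₗ[ℝ] V →ₗ[ℝ] ℝ := LinearMap.mk₂ ℝ
    (fun p q => ∫ x in α..β, p.1.eval x * q.1.eval x)
    (fun p p' q => by
      simp only [Submodule.coe_add, Polynomial.eval_add, add_mul]
      exact intervalIntegral.integral_add (hint _ _) (hint _ _))
    (fun c p q => by
      simp only [Submodule.coe_smul, Polynomial.eval_smul, smul_eq_mul, mul_assoc]
      exact intervalIntegral.integral_const_mul _ _)
    (fun p q q' => by
      simp only [Submodule.coe_add, Polynomial.eval_add, mul_add]
      exact intervalIntegral.integral_add (hint _ _) (hint _ _))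
    (fun c p q => by
      simp only [Submodule.coe_smul, Polynomial.eval_smul, smul_eq_mul, mul_left_comm _ c]
      exact intervalIntegral.integral_const_mul _ _)
  let L : V →ₗ[ℝ] ℝ :=
    { toFun := fun q => -(∫ x in α..β, v.eval x * q.1.derivative.eval x)
        + vβ * q.1.eval β - vα * q.1.eval α
      map_add' := fun q q' => by
        simp only [Submodule.coe_add, Polynomial.derivative_add, Polynomial.eval_add, mul_add]
        rw [intervalIntegral.integral_add (hint _ _) (hint _ _)]
        ring
      map_smul' := fun c q => by
        simp only [Submodule.coe_smul, Polynomial.derivative_smul, Polynomial.eval_smul,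
          smul_eq_mul, mul_left_comm _ c, RingHom.id_apply]
        rw [intervalIntegral.integral_const_mul]
        ring }
  have hinj : Function.Injective B := by
    rw [injective_iff_map_eq_zero]
    intro p hp
    have h0 : B p p = 0 := by rw [hp]; rfl
    exact Subtype.ext (eq_zero_of_integral_sq h p.1 h0)
  have hsurj : Function.Surjective B :=
    (LinearMap.injective_iff_surjective_of_finrank_eq_finrank
      (Subspace.dual_finrank_eq (K := ℝ) (V := V)).symm).mp hinj
  obtain ⟨d, hd⟩ := hsurj L
  refine ⟨d.1, ⟨(hmem _).1 d.2, fun q hq => ?_⟩, fun e he => ?_⟩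
  · exact congrArg (fun F : V →ₗ[ℝ] ℝ => F ⟨q, (hmem q).2 hq⟩) hd
  · have hBe : B ⟨e, (hmem e).2 he.1⟩ = L :=
      LinearMap.ext fun q => he.2 q.1 ((hmem _).1 q.2)
    exact congrArg Subtype.val (hinj (hBe.trans hd.symm))

namespace WeakFunction

variable {a b : ℝ} {T : Partition a b} {k : ℕ}

/-- The interior component `v⁰` as a function on `(a, b)`, piecewise polynomial (with value `0` at
the nodes, a null set). -/
def interiorFun (v : WeakFunction T k) (x : ℝ) : ℝ :=
  ∑ i, (Ioo (T.lo i) (T.hi i)).indicator (fun y => (v.interior i).eval y) x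

/-- The discrete weak derivative `d_{w,r} v` on the `i`-th element. -/
def dw (r : ℕ) (v : WeakFunction T k) (i : Fin (T.n + 1)) : Polynomial ℝ :=
  (existsUnique_discreteWeakDeriv r (T.lo_lt_hi i) (v.interior i) (v.left i) (v.right i)).choose

/-- The jump of `v` at the `i`-th interior node, which is the common endpoint of the elements
`i.castSucc` and `i.succ`. -/
def jump (v : WeakFunction T k) (i : Fin T.n) : ℝ :=
  v.left i.succ - v.right i.castSucc

end WeakFunction

/-- The weak finite element space `S_h`: single valued at the interior nodes, zero at `a`. -/
def weakFESpace {a b : ℝ} (T : Partition a b) (k : ℕ) : Set (WeakFunction T k) :=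
  {v | v.left 0 = 0 ∧ ∀ i : Fin T.n, v.jump i = 0}

/-- `u_h ∈ S_h` is a weak finite element approximation:
`(a₂ d_{w,r} u_h, d_{w,r} v)_h + (a₀ u_h⁰, v⁰) = (f, v⁰)` for all `v ∈ S_h`. -/
def IsWeakFESolution {a b : ℝ} (T : Partition a b) (k r : ℕ) (a₂ a₀ f : ℝ → ℝ)
    (uh : WeakFunction T k) : Prop :=
  uh ∈ weakFESpace T k ∧ ∀ v ∈ weakFESpace T k,
    (∑ i, ∫ x in (T.lo i)..(T.hi i), a₂ x * (uh.dw r i).eval x * (v.dw r i).eval x)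
      + (∫ x in a..b, a₀ x * uh.interiorFun x * v.interiorFun x) = ∫ x in a..b, f x * v.interiorFun x

end WeakFEM

end

noncomputable section
namespace WeakFEM

/-! ### The space `L_2` of an interval -/

section L2

variable {a b : ℝ} {f g : ℝ → ℝ}

/-! Write Pψ for the primitive `prim a ψ` and Π for the elementwise L_2 projection onto polynomials
of degree at most k. Because r = k+1, a function v in S_h is the same thing as a piecewise
polynomial ψ of degree at most k+1: its weak derivative is ψ, its node values are those of Pψ, and
its interior part is ΠPψ (`WeakFunction.left_eq_prim`, `WeakFunction.isProj_interior`,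
`WeakFunction.exists_dw_eq`). With p the weak derivative of u_h, the method reads (a₂ p, ψ) + (a₀
ΠPp, ΠPψ) = (f, ΠPψ) for every such ψ.

Let σ = a₂u' be the flux, so that σ' = a₀u - f and σ(b) = 0. Integration by parts gives the error
equation (a₂(u'-p), ψ) + (a₀(u-ΠPp), ΠPψ) = -(σ', Pψ-ΠPψ). Since H^k is an algebra, σ' lies in
H^{k-1}. Subtracting a piecewise polynomial from σ' bounds the right side by a multiple of
h^{k-1}‖Pψ-ΠPψ‖ (`exists_error_equation`). Two consequences are used: the right side is O(h^k)‖ψ‖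
for general ψ, and it is zero for piecewise constant ψ, because Pψ is then piecewise linear and k ≥
1.

Energy step (`normL2_deriv_error_le`): taking ψ = q-p, with q a piecewise approximation of u', gives
‖u'-p‖ = O(h^k); the sign of a₀ removes the term without a small factor.

Duality step (`normL2_error_le`): the dual problem -(a₂w')' = g omits a₀, so w' = (∫_x^b g)/a₂ is
explicit and is approximated by piecewise constants to order h‖g‖. Those are tests without
consistency error, which gains the missing power of h. The a₀ term left out of the dual problem is
recovered from the positivity of g ↦ w (`normL2_le_of_dual`).

Sobolev functions are handled as iterated primitives (`SobolevBound`). The embedding, the algebra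
property and the approximation by polynomials then follow by repeated integration. -/

theorem memL2_congr (h : f =ᵐ[volume.restrict (Ioo a b)] g) (hf : MemL2 a b f) : MemL2 a b g :=
  MemLp.ae_eq h hf

theorem integral_congr_ae_Ioo (hab : a ≤ b) (h : f =ᵐ[volume.restrict (Ioo a b)] g) :
    ∫ x in a..b, f x = ∫ x in a..b, g x := by
  rw [intervalIntegral.integral_of_le hab, intervalIntegral.integral_of_le hab,
    integral_Ioc_eq_integral_Ioo, integral_Ioc_eq_integral_Ioo]
  exact integral_congr_ae h

theorem integral_congr_Ioo (hab : a ≤ b) (h : ∀ x ∈ Ioo a b, f x = g x) :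
    ∫ x in a..b, f x = ∫ x in a..b, g x :=
  integral_congr_ae_Ioo hab ((ae_restrict_iff' measurableSet_Ioo).2 (ae_of_all _ h))

theorem normL2_congr (hab : a ≤ b) (h : f =ᵐ[volume.restrict (Ioo a b)] g) :
    normL2 a b f = normL2 a b g := by
  unfold normL2
  congr 1
  exact integral_congr_ae_Ioo hab (h.mono fun x hx => by simp only [hx])

theorem intervalIntegrable_of_integrableOn_Ioo (hab : a ≤ b) (h : IntegrableOn f (Ioo a b)) :
    IntervalIntegrable f volume a b := by
  rw [intervalIntegrable_iff_integrableOn_Ioo_of_le hab]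
  exact h

theorem MemL2.integrableOn (hf : MemL2 a b f) : IntegrableOn f (Ioo a b) :=
  MemLp.integrable (by norm_num) hf

theorem MemL2.intervalIntegrable (hab : a ≤ b) (hf : MemL2 a b f) :
    IntervalIntegrable f volume a b :=
  intervalIntegrable_of_integrableOn_Ioo hab hf.integrableOn

theorem MemL2.intervalIntegrable_mul (hab : a ≤ b) (hf : MemL2 a b f) (hg : MemL2 a b g) :
    IntervalIntegrable (fun x => f x * g x) volume a b :=
  intervalIntegrable_of_integrableOn_Ioo hab (MemLp.integrable_mul hf hg)

theorem MemL2.intervalIntegrable_sq (hab : a ≤ b) (hf : MemL2 a b f) :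
    IntervalIntegrable (fun x => f x ^ 2) volume a b := by
  simpa only [pow_two] using hf.intervalIntegrable_mul hab hf

theorem MemL2.add (hf : MemL2 a b f) (hg : MemL2 a b g) : MemL2 a b (fun x => f x + g x) :=
  MemLp.add hf hg

theorem MemL2.sub (hf : MemL2 a b f) (hg : MemL2 a b g) : MemL2 a b (fun x => f x - g x) :=
  MemLp.sub hf hg

theorem MemL2.neg (hf : MemL2 a b f) : MemL2 a b (fun x => -f x) :=
  MemLp.neg hf

theorem MemL2.mono {c d : ℝ} (hf : MemL2 a b f) (hac : a ≤ c) (hdb : d ≤ b) : MemL2 c d f :=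
  MemLp.mono_measure (Measure.restrict_mono (Ioo_subset_Ioo hac hdb) le_rfl) hf

theorem MemL2.bdd_mul {A : ℝ} {c : ℝ → ℝ} (hf : MemL2 a b f)
    (hc : AEStronglyMeasurable c (volume.restrict (Ioo a b)))
    (hA : ∀ᵐ x ∂(volume.restrict (Ioo a b)), |c x| ≤ A) : MemL2 a b (fun x => c x * f x) :=
  MemLp.of_le_mul hf (hc.mul hf.1) (hA.mono fun x hx => by
    rw [norm_mul]
    exact mul_le_mul_of_nonneg_right hx (norm_nonneg _))

theorem memL2_of_continuousOn (hf : ContinuousOn f (Icc a b)) : MemL2 a b f := by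
  obtain ⟨C, hC⟩ := isCompact_Icc.exists_bound_of_continuousOn hf
  refine MemLp.of_bound ((hf.mono Ioo_subset_Icc_self).aestronglyMeasurable measurableSet_Ioo) C ?_
  exact (ae_restrict_iff' measurableSet_Ioo).2 (ae_of_all _ fun x hx => hC x ⟨hx.1.le, hx.2.le⟩)

theorem normL2_nonneg : 0 ≤ normL2 a b f := Real.sqrt_nonneg _

theorem normL2_sq (hab : a ≤ b) : normL2 a b f ^ 2 = ∫ x in a..b, f x ^ 2 :=
  Real.sq_sqrt (intervalIntegral.integral_nonneg hab fun _ _ => sq_nonneg _)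

theorem normL2_le_of_sq_le {B : ℝ} (hB : 0 ≤ B) (h : ∫ x in a..b, f x ^ 2 ≤ B ^ 2) :
    normL2 a b f ≤ B :=
  Real.sqrt_le_iff.2 ⟨hB, h⟩

theorem normL2_neg : normL2 a b (fun x => -f x) = normL2 a b f := by
  simp [normL2]

/-- The quadratic t ↦ ∫ (t f + g)² is nonnegative, so its discriminant is not positive. -/
theorem abs_integral_mul_le (hab : a ≤ b) (hf : MemL2 a b f) (hg : MemL2 a b g) :
    |∫ x in a..b, f x * g x| ≤ normL2 a b f * normL2 a b g := by
  have hff := hf.intervalIntegrable_sq hab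
  have hgg := hg.intervalIntegrable_sq hab
  have hfg := hf.intervalIntegrable_mul hab hg
  have key : ∀ t : ℝ, 0 ≤ (∫ x in a..b, f x ^ 2) * (t * t) + (2 * ∫ x in a..b, f x * g x) * t
      + ∫ x in a..b, g x ^ 2 := by
    intro t
    have h0 : 0 ≤ ∫ x in a..b, (t * f x + g x) ^ 2 :=
      intervalIntegral.integral_nonneg hab fun _ _ => sq_nonneg _
    have h1 : ∀ x, (t * f x + g x) ^ 2 = t * t * f x ^ 2 + 2 * t * (f x * g x) + g x ^ 2 :=
      fun x => by ring
    simp only [h1] at h0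
    rw [intervalIntegral.integral_add ((hff.const_mul _).add (hfg.const_mul _)) hgg,
      intervalIntegral.integral_add (hff.const_mul _) (hfg.const_mul _),
      intervalIntegral.integral_const_mul, intervalIntegral.integral_const_mul] at h0
    linarith
  have hd := discrim_le_zero key
  rw [discrim, ← normL2_sq hab, ← normL2_sq hab] at hd
  refine abs_le_of_sq_le_sq ?_ (mul_nonneg normL2_nonneg normL2_nonneg)
  nlinarith

theorem normL2_add_le (hab : a ≤ b) (hf : MemL2 a b f) (hg : MemL2 a b g) :
    normL2 a b (fun x => f x + g x) ≤ normL2 a b f + normL2 a b g := by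
  refine normL2_le_of_sq_le (add_nonneg normL2_nonneg normL2_nonneg) ?_
  have h1 : ∀ x, (f x + g x) ^ 2 = f x ^ 2 + 2 * (f x * g x) + g x ^ 2 := fun x => by ring
  have hff := hf.intervalIntegrable_sq hab
  have hgg := hg.intervalIntegrable_sq hab
  have hfg := hf.intervalIntegrable_mul hab hg
  simp only [h1]
  rw [intervalIntegral.integral_add (hff.add (hfg.const_mul _)) hgg,
    intervalIntegral.integral_add hff (hfg.const_mul _), intervalIntegral.integral_const_mul,
    ← normL2_sq hab, ← normL2_sq hab]
  have := le_of_abs_le (abs_integral_mul_le hab hf hg)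
  nlinarith

theorem normL2_sub_le (hab : a ≤ b) (hf : MemL2 a b f) (hg : MemL2 a b g) :
    normL2 a b (fun x => f x - g x) ≤ normL2 a b f + normL2 a b g := by
  have := normL2_add_le hab hf hg.neg
  rw [normL2_neg] at this
  simpa only [← sub_eq_add_neg] using this

theorem normL2_mono (hab : a ≤ b) (hg : MemL2 a b g)
    (h : ∀ᵐ x ∂(volume.restrict (Ioo a b)), |f x| ≤ |g x|) : normL2 a b f ≤ normL2 a b g := by
  apply Real.sqrt_le_sqrt
  rw [intervalIntegral.integral_of_le hab, intervalIntegral.integral_of_le hab,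
    integral_Ioc_eq_integral_Ioo, integral_Ioc_eq_integral_Ioo]
  refine integral_mono_of_nonneg (ae_of_all _ fun _ => sq_nonneg _) ?_
    (h.mono fun x hx => sq_le_sq.2 hx)
  have : Integrable (fun x => g x * g x) (volume.restrict (Ioo a b)) := MemLp.integrable_mul hg hg
  simpa only [pow_two] using this

theorem normL2_const_mul (c : ℝ) :
    normL2 a b (fun x => c * f x) = |c| * normL2 a b f := by
  have h1 : ∀ x, (c * f x) ^ 2 = c ^ 2 * f x ^ 2 := fun x => by ring
  simp only [normL2, h1]
  rw [intervalIntegral.integral_const_mul, Real.sqrt_mul (sq_nonneg c), Real.sqrt_sq_eq_abs]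

theorem MemL2.const_mul (hf : MemL2 a b f) (c : ℝ) : MemL2 a b (fun x => c * f x) :=
  MemLp.const_mul hf c

theorem normL2_bdd_mul_le {A : ℝ} {c : ℝ → ℝ} (hab : a ≤ b) (hf : MemL2 a b f) (hA0 : 0 ≤ A)
    (hA : ∀ᵐ x ∂(volume.restrict (Ioo a b)), |c x| ≤ A) :
    normL2 a b (fun x => c x * f x) ≤ A * normL2 a b f := by
  rw [← abs_of_nonneg hA0, ← normL2_const_mul]
  refine normL2_mono hab (hf.const_mul A) (hA.mono fun x hx => ?_)
  rw [abs_mul, abs_mul, abs_of_nonneg hA0]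
  exact mul_le_mul_of_nonneg_right hx (abs_nonneg _)

theorem memL2_const (c : ℝ) : MemL2 a b (fun _ => c) :=
  memL2_of_continuousOn continuousOn_const

theorem normL2_const (c : ℝ) :
    normL2 a b (fun _ => c) = |c| * Real.sqrt (b - a) := by
  simp only [normL2, intervalIntegral.integral_const, smul_eq_mul]
  rw [mul_comm, Real.sqrt_mul (sq_nonneg c), Real.sqrt_sq_eq_abs]

theorem normL2_le_of_abs_le {B : ℝ} (hab : a ≤ b) (hB : 0 ≤ B) (h : ∀ x ∈ Ioo a b, |f x| ≤ B) :
    normL2 a b f ≤ B * Real.sqrt (b - a) := by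
  have := normL2_const (a := a) (b := b) B
  rw [abs_of_nonneg hB] at this
  rw [← this]
  refine normL2_mono hab (memL2_const B) ((ae_restrict_iff' measurableSet_Ioo).2
    (ae_of_all _ fun x hx => ?_))
  rw [abs_of_nonneg hB]
  exact h x hx

theorem normL2_le_normL2_of_subset {c d : ℝ} (hac : a ≤ c) (hcd : c ≤ d) (hdb : d ≤ b)
    (hf : MemL2 a b f) : normL2 c d f ≤ normL2 a b f := by
  apply Real.sqrt_le_sqrt
  exact intervalIntegral.integral_mono_interval hac hcd hdb (ae_of_all _ fun _ => sq_nonneg _)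
    (hf.intervalIntegrable_sq (hac.trans (hcd.trans hdb)))

/-- The primitive vanishing at `a`. -/
def prim (a : ℝ) (f : ℝ → ℝ) (x : ℝ) : ℝ := ∫ t in a..x, f t

theorem abs_prim_le {x : ℝ} (hf : MemL2 a b f) (hx : x ∈ Icc a b) :
    |prim a f x| ≤ Real.sqrt (b - a) * normL2 a b f := by
  have h1 := abs_integral_mul_le hx.1 (memL2_const 1) (hf.mono le_rfl hx.2)
  rw [normL2_const] at h1
  simp only [one_mul, abs_one] at h1
  refine h1.trans (mul_le_mul (Real.sqrt_le_sqrt (by linarith [hx.2]))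
    (normL2_le_normL2_of_subset le_rfl hx.1 hx.2 hf) normL2_nonneg (Real.sqrt_nonneg _))

theorem normL2_prim_le (hab : a ≤ b) (hf : MemL2 a b f) :
    normL2 a b (prim a f) ≤ (b - a) * normL2 a b f := by
  have := normL2_le_of_abs_le hab (mul_nonneg (Real.sqrt_nonneg _) normL2_nonneg)
    (fun x hx => abs_prim_le hf ⟨hx.1.le, hx.2.le⟩)
  calc _ ≤ _ := this
    _ = Real.sqrt (b - a) * Real.sqrt (b - a) * normL2 a b f := by ring
    _ = _ := by rw [Real.mul_self_sqrt (by linarith)]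

theorem continuousOn_prim (hab : a ≤ b) (hf : IntervalIntegrable f volume a b) :
    ContinuousOn (prim a f) (Icc a b) := by
  have := intervalIntegral.continuousOn_primitive_interval' hf (left_mem_uIcc)
  rwa [uIcc_of_le hab] at this

theorem memL2_prim (hab : a ≤ b) (hf : MemL2 a b f) : MemL2 a b (prim a f) :=
  memL2_of_continuousOn (continuousOn_prim hab (hf.intervalIntegrable hab))

theorem prim_sub (hf : MemL2 a b f) (hg : MemL2 a b g) {x : ℝ} (hx : x ∈ Icc a b) :
    prim a (fun t => f t - g t) x = prim a f x - prim a g x :=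
  intervalIntegral.integral_sub ((hf.mono le_rfl hx.2).intervalIntegrable hx.1)
    ((hg.mono le_rfl hx.2).intervalIntegrable hx.1)

theorem prim_congr {x : ℝ} (h : f =ᵐ[volume.restrict (Ioo a b)] g) (hx : x ∈ Icc a b) :
    prim a f x = prim a g x :=
  integral_congr_ae_Ioo hx.1
    (ae_mono (Measure.restrict_mono (Ioo_subset_Ioo le_rfl hx.2) le_rfl) h)

/-! ### Integration by parts for primitives -/

theorem ae_hasDerivAt_const_add_prim (hab : a ≤ b) (hf : IntervalIntegrable f volume a b) (c : ℝ) :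
    ∀ᵐ x, x ∈ Icc a b → HasDerivAt (fun y => c + prim a f y) (f x) x := by
  filter_upwards [hf.ae_hasDerivAt_integral] with x hx hxm
  exact (hx (by rwa [uIcc_of_le hab]) a left_mem_uIcc).const_add c

/-- Primitives of integrable functions are absolutely continuous, and their derivatives exist almost
everywhere by Lebesgue differentiation. No continuity of the integrands is needed, so this applies
to L_2 derivatives. -/
theorem integral_primitive_mul (hab : a ≤ b) {F G : ℝ → ℝ}
    (hf : IntervalIntegrable f volume a b) (hg : IntervalIntegrable g volume a b)
    (hF : ∀ x ∈ Icc a b, F x = F a + prim a f x) (hG : ∀ x ∈ Icc a b, G x = G a + prim a g x) :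
    ∫ x in a..b, (f x * G x + F x * g x) = F b * G b - F a * G a := by
  have hAC : ∀ {f : ℝ → ℝ} (c : ℝ), IntervalIntegrable f volume a b →
      AbsolutelyContinuousOnInterval (fun x => c + prim a f x) a b := fun {f} c hf =>
    AbsolutelyContinuousOnInterval.add
      ((contDiff_const (c := c)).contDiffOn.absolutelyContinuousOnInterval)
      (hf.absolutelyContinuousOnInterval_intervalIntegral left_mem_uIcc)
  have key := (hAC (F a) hf).integral_deriv_mul_eq_sub (hAC (G a) hg)
  have hFb := hF b ⟨hab, le_rfl⟩
  have hGb := hG b ⟨hab, le_rfl⟩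
  have hz : ∀ f : ℝ → ℝ, prim a f a = 0 := fun f => intervalIntegral.integral_same
  rw [← hFb, ← hGb, hz, hz, add_zero, add_zero] at key
  rw [← key]
  refine intervalIntegral.integral_congr_ae ?_
  filter_upwards [ae_hasDerivAt_const_add_prim hab hf (F a),
    ae_hasDerivAt_const_add_prim hab hg (G a)] with x h1 h2 hx
  rw [uIoc_of_le hab] at hx
  have hx' : x ∈ Icc a b := ⟨hx.1.le, hx.2⟩
  rw [(h1 hx').deriv, (h2 hx').deriv, hF x hx', hG x hx']

theorem ae_eq_of_prim_eq (hab : a ≤ b) (hf : IntervalIntegrable f volume a b)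
    (hg : IntervalIntegrable g volume a b) (c d : ℝ)
    (h : ∀ x ∈ Ioo a b, c + prim a f x = d + prim a g x) :
    f =ᵐ[volume.restrict (Ioo a b)] g := by
  rw [EventuallyEq, ae_restrict_iff' measurableSet_Ioo]
  filter_upwards [ae_hasDerivAt_const_add_prim hab hf c, ae_hasDerivAt_const_add_prim hab hg d]
    with x h1 h2 hx
  have hx' : x ∈ Icc a b := ⟨hx.1.le, hx.2.le⟩
  refine (h1 hx').unique ((h2 hx').congr_of_eventuallyEq ?_)
  filter_upwards [isOpen_Ioo.mem_nhds hx] with y hy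
  exact h y hy

end L2

/-! ### Sobolev functions as iterated primitives -/

/-- `g` has `m` successive derivatives in the sense of primitives on `[a, b]`, all of which (and `g`
itself) have `L_2` norm at most `M`. -/
def SobolevBound (a b : ℝ) : ℕ → ℝ → (ℝ → ℝ) → Prop
  | 0, M, g => MemL2 a b g ∧ normL2 a b g ≤ M
  | m + 1, M, g => (MemL2 a b g ∧ normL2 a b g ≤ M) ∧
      ∃ g' : ℝ → ℝ, (∀ x ∈ Icc a b, g x = g a + prim a g' x) ∧ SobolevBound a b m M g'

namespace SobolevBound

variable {a b A B M : ℝ} {m : ℕ} {f g : ℝ → ℝ}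

theorem memL2 (h : SobolevBound a b m M g) : MemL2 a b g := by
  cases m with
  | zero => exact h.1
  | succ m => exact h.1.1

theorem norm_le (h : SobolevBound a b m M g) : normL2 a b g ≤ M := by
  cases m with
  | zero => exact h.2
  | succ m => exact h.1.2

theorem nonneg (h : SobolevBound a b m M g) : 0 ≤ M := normL2_nonneg.trans h.norm_le

theorem of_succ (h : SobolevBound a b (m + 1) M g) : SobolevBound a b m M g := by
  induction m generalizing g with
  | zero => exact h.1
  | succ m ih =>
    obtain ⟨h1, g', h2, h3⟩ := h
    exact ⟨h1, g', h2, ih h3⟩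

theorem of_le {n : ℕ} (h : SobolevBound a b n M g) (hmn : m ≤ n) : SobolevBound a b m M g := by
  induction n, hmn using Nat.le_induction with
  | base => exact h
  | succ n _ ih => exact ih h.of_succ

theorem mono (h : SobolevBound a b m A g) (hAB : A ≤ B) : SobolevBound a b m B g := by
  induction m generalizing g with
  | zero => exact ⟨h.1, h.2.trans hAB⟩
  | succ m ih =>
    obtain ⟨h1, g', h2, h3⟩ := h
    exact ⟨⟨h1.1, h1.2.trans hAB⟩, g', h2, ih h3⟩

theorem add (hab : a ≤ b) (hf : SobolevBound a b m A f) (hg : SobolevBound a b m B g) :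
    SobolevBound a b m (A + B) (fun x => f x + g x) := by
  have h0 := (normL2_add_le hab hf.memL2 hg.memL2).trans (add_le_add hf.norm_le hg.norm_le)
  induction m generalizing f g with
  | zero => exact ⟨hf.memL2.add hg.memL2, h0⟩
  | succ m ih =>
    refine ⟨⟨hf.memL2.add hg.memL2, h0⟩, ?_⟩
    obtain ⟨-, f', hf2, hf3⟩ := hf
    obtain ⟨-, g', hg2, hg3⟩ := hg
    refine ⟨fun x => f' x + g' x, fun x hx => ?_, ih hf3 hg3
      ((normL2_add_le hab hf3.memL2 hg3.memL2).trans (add_le_add hf3.norm_le hg3.norm_le))⟩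
    have : prim a (fun x => f' x + g' x) x = prim a f' x + prim a g' x :=
      intervalIntegral.integral_add ((hf3.memL2.mono le_rfl hx.2).intervalIntegrable hx.1)
        ((hg3.memL2.mono le_rfl hx.2).intervalIntegrable hx.1)
    have e1 := hf2 x hx
    have e2 := hg2 x hx
    simp only [this]
    linarith

theorem continuousOn (hab : a ≤ b) (h : SobolevBound a b (m + 1) M g) :
    ContinuousOn g (Icc a b) := by
  obtain ⟨-, g', h2, h3⟩ := h
  exact (continuousOn_const.add
    (continuousOn_prim hab (h3.memL2.intervalIntegrable hab))).congr h2

/-- The constant of the embedding of `H^1` into the continuous functions. -/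
def supConst (a b : ℝ) : ℝ := (1 + (b - a)) / Real.sqrt (b - a) + Real.sqrt (b - a)

theorem supConst_nonneg (hab : a ≤ b) : 0 ≤ supConst a b := by
  have : 0 ≤ b - a := sub_nonneg.2 hab
  unfold supConst
  positivity

/-- The constant g(a) is the difference of g and a primitive, both controlled in L_2, and the L_2
norm of a constant is its modulus times √(b-a). This bounds g(a); the primitive is bounded by
Cauchy-Schwarz. -/
theorem abs_le (hab : a < b) (h : SobolevBound a b (m + 1) M g) {x : ℝ} (hx : x ∈ Icc a b) :
    |g x| ≤ supConst a b * M := by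
  obtain ⟨h1, g', h2, h3⟩ := h
  have hL : 0 < b - a := sub_pos.2 hab
  have hs : 0 < Real.sqrt (b - a) := Real.sqrt_pos.2 hL
  have hp := abs_prim_le h3.memL2 hx
  have hpm := hp.trans (mul_le_mul_of_nonneg_left h3.norm_le hs.le)
  have hpn := (normL2_prim_le hab.le h3.memL2).trans (mul_le_mul_of_nonneg_left h3.norm_le hL.le)
  have hc : normL2 a b (fun _ => g a) ≤ M + (b - a) * M := by
    have h4 : normL2 a b (fun x => g x - prim a g' x) = normL2 a b (fun _ => g a) := by
      refine normL2_congr hab.le ((ae_restrict_iff' measurableSet_Ioo).2 (ae_of_all _ fun y hy => ?_))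
      have := h2 y ⟨hy.1.le, hy.2.le⟩
      linarith
    rw [← h4]
    exact (normL2_sub_le hab.le h1.1 (memL2_prim hab.le h3.memL2)).trans (add_le_add h1.2 hpn)
  rw [normL2_const] at hc
  have hga : |g a| ≤ (1 + (b - a)) / Real.sqrt (b - a) * M := by
    rw [div_mul_eq_mul_div, le_div_iff₀ hs]
    linarith
  rw [h2 x hx]
  calc _ ≤ |g a| + |prim a g' x| := abs_add_le _ _
    _ ≤ _ := add_le_add hga hpm
    _ = _ := by unfold supConst; ring

theorem mul_zero_one (hab : a < b) (hf : SobolevBound a b 0 A f) (hg : SobolevBound a b (m + 1) B g) :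
    SobolevBound a b 0 (supConst a b * (A * B)) (fun x => f x * g x) := by
  have hgm : AEStronglyMeasurable g (volume.restrict (Ioo a b)) := hg.memL2.1
  have hgb : ∀ᵐ x ∂(volume.restrict (Ioo a b)), |g x| ≤ supConst a b * B :=
    (ae_restrict_iff' measurableSet_Ioo).2
      (ae_of_all _ fun x hx => hg.abs_le hab ⟨hx.1.le, hx.2.le⟩)
  have hB : 0 ≤ supConst a b * B := mul_nonneg (supConst_nonneg hab.le) hg.nonneg
  have h1 := hf.memL2.bdd_mul hgm hgb
  have h2 := (normL2_bdd_mul_le hab.le hf.memL2 hB hgb).trans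
    (mul_le_mul_of_nonneg_left hf.norm_le hB)
  simp only [mul_comm (g _)] at h1 h2
  exact ⟨h1, h2.trans_eq (by ring)⟩

/-- Inductive step for products by the Leibniz rule: in f'g + g'f each summand pairs a factor with m
derivatives and a factor with m+1, which is the form of the assumption `hC`. -/
theorem mul_succ_aux (hab : a < b) {C : ℝ}
    (hC : ∀ {A B : ℝ} {f g : ℝ → ℝ}, SobolevBound a b m A f → SobolevBound a b (m + 1) B g →
      SobolevBound a b m (C * (A * B)) (fun x => f x * g x)) (hC0 : 0 ≤ C)
    (hf : SobolevBound a b (m + 1) A f) (hg : SobolevBound a b (m + 1) B g) :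
    SobolevBound a b (m + 1) ((supConst a b + 2 * C) * (A * B)) (fun x => f x * g x) := by
  have h0 := mul_zero_one hab (hf.of_le (Nat.zero_le _)) hg
  have hAB : 0 ≤ A * B := mul_nonneg hf.nonneg hg.nonneg
  have hK := supConst_nonneg hab.le
  obtain ⟨hf1, f', hf2, hf3⟩ := id hf
  obtain ⟨hg1, g', hg2, hg3⟩ := id hg
  refine ⟨⟨h0.memL2, h0.norm_le.trans (by nlinarith [mul_nonneg hC0 hAB])⟩,
    fun x => f' x * g x + g' x * f x, fun x hx => ?_,
    ((hC hf3 hg).add hab.le (hC hg3 hf)).mono (by nlinarith [mul_nonneg hK hAB])⟩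
  have key := integral_primitive_mul hx.1
    ((hf3.memL2.mono le_rfl hx.2).intervalIntegrable hx.1)
    ((hg3.memL2.mono le_rfl hx.2).intervalIntegrable hx.1)
    (fun y hy => hf2 y ⟨hy.1, hy.2.trans hx.2⟩) (fun y hy => hg2 y ⟨hy.1, hy.2.trans hx.2⟩)
  simp only [prim, mul_comm (g' _)]
  linarith

/-- The asymmetric form, with one more derivative on the second factor, makes the induction start at
m = 0: an L_2 function times a bounded one. -/
theorem exists_mul (hab : a < b) (m : ℕ) : ∃ C : ℝ, 0 ≤ C ∧ ∀ {A B : ℝ} {f g : ℝ → ℝ},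
    SobolevBound a b m A f → SobolevBound a b (m + 1) B g →
      SobolevBound a b m (C * (A * B)) (fun x => f x * g x) := by
  induction m with
  | zero => exact ⟨supConst a b, supConst_nonneg hab.le, fun hf hg => mul_zero_one hab hf hg⟩
  | succ m ih =>
    obtain ⟨C, hC0, hC⟩ := ih
    exact ⟨supConst a b + 2 * C, add_nonneg (supConst_nonneg hab.le) (by linarith),
      fun hf hg => mul_succ_aux hab hC hC0 hf hg.of_succ⟩

/-- `H^m` of an interval is an algebra for `m ≥ 1`. -/
theorem exists_mul_succ (hab : a < b) (m : ℕ) : ∃ C : ℝ, 0 ≤ C ∧ ∀ {A B : ℝ} {f g : ℝ → ℝ},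
    SobolevBound a b (m + 1) A f → SobolevBound a b (m + 1) B g →
      SobolevBound a b (m + 1) (C * (A * B)) (fun x => f x * g x) := by
  obtain ⟨C, hC0, hC⟩ := exists_mul hab m
  exact ⟨supConst a b + 2 * C, add_nonneg (supConst_nonneg hab.le) (by linarith),
      fun hf hg => mul_succ_aux hab hC hC0 hf hg⟩

end SobolevBound

/-! ### Polynomial approximation on an element -/

theorem exists_derivative_eq (p : Polynomial ℝ) (α c : ℝ) :
    ∃ P : Polynomial ℝ, P.derivative = p ∧ P.eval α = c ∧
      ∀ m : ℕ, p.degree < m → P.degree < (m + 1 : ℕ) := by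
  have h1 : ∃ P : Polynomial ℝ, P.derivative = p := by
    induction p using Polynomial.induction_on' with
    | add p q hp hq =>
      obtain ⟨P, rfl⟩ := hp
      obtain ⟨Q, rfl⟩ := hq
      exact ⟨P + Q, Polynomial.derivative_add⟩
    | monomial n r =>
      refine ⟨Polynomial.monomial (n + 1) (r / (n + 1)), ?_⟩
      rw [Polynomial.derivative_monomial]
      have : (n : ℝ) + 1 ≠ 0 := by positivity
      simp [this]
  obtain ⟨P, hP⟩ := h1
  have h2 : (P + Polynomial.C (c - P.eval α)).derivative = p := by simp [hP]
  refine ⟨P + Polynomial.C (c - P.eval α), h2, by simp, fun m hm => ?_⟩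
  rw [Polynomial.degree_lt_iff_coeff_zero] at hm ⊢
  intro n hn
  obtain ⟨n, rfl⟩ : ∃ j, n = j + 1 := ⟨n - 1, by omega⟩
  have h3 := hm n (by omega)
  rw [← h2, Polynomial.coeff_derivative] at h3
  exact (mul_eq_zero.1 h3).resolve_right (by positivity)

theorem eval_eq_add_integral_derivative (P : Polynomial ℝ) (α x : ℝ) :
    P.eval x = P.eval α + ∫ t in α..x, P.derivative.eval t := by
  rw [intervalIntegral.integral_eq_sub_of_hasDerivAt (fun t _ => P.hasDerivAt t)
    (Continuous.intervalIntegrable (by fun_prop) _ _)]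
  ring

theorem memL2_polynomial (p : Polynomial ℝ) {α β : ℝ} : MemL2 α β (fun x => p.eval x) :=
  memL2_of_continuousOn (by fun_prop)

theorem sub_eq_prim_of_subset {a b α x : ℝ} {g g' : ℝ → ℝ} (haα : a ≤ α) (hαx : α ≤ x) (hxb : x ≤ b)
    (hg' : MemL2 a b g') (h : ∀ x ∈ Icc a b, g x = g a + prim a g' x) :
    g x = g α + prim α g' x := by
  rw [h x ⟨haα.trans hαx, hxb⟩, h α ⟨haα, hαx.trans hxb⟩, add_assoc]
  congr 1
  exact (intervalIntegral.integral_add_adjacent_intervals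
    ((hg'.mono le_rfl (hαx.trans hxb)).intervalIntegrable haα)
    ((hg'.mono haα hxb).intervalIntegrable hαx)).symm

theorem normL2_sub_const_le {a b α β : ℝ} {g g' : ℝ → ℝ} (haα : a ≤ α) (hαβ : α ≤ β) (hβb : β ≤ b)
    (hg' : MemL2 a b g') (h : ∀ x ∈ Icc a b, g x = g a + prim a g' x) :
    normL2 α β (fun x => g x - g α) ≤ (β - α) * normL2 α β g' := by
  have h1 : normL2 α β (fun x => g x - g α) = normL2 α β (prim α g') := by
    refine normL2_congr hαβ ((ae_restrict_iff' measurableSet_Ioo).2 (ae_of_all _ fun y hy => ?_))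
    have := sub_eq_prim_of_subset haα hy.1.le (hy.2.le.trans hβb) hg' h
    linarith
  rw [h1]
  exact normL2_prim_le hαβ (hg'.mono haα hβb)

/-- Approximate g' first, then integrate the polynomial with matching value at α; each integration
costs one factor β-α. The function `gm` is the top derivative, chosen before the interval, so that
local estimates can later be squared and summed. Measuring by `degree` makes m = 0 force the zero
polynomial. -/
theorem SobolevBound.exists_polynomial_approx {a b M : ℝ} {m : ℕ} {g : ℝ → ℝ}
    (h : SobolevBound a b m M g) :
    ∃ gm : ℝ → ℝ, MemL2 a b gm ∧ normL2 a b gm ≤ M ∧ ∀ α β : ℝ, a ≤ α → α ≤ β → β ≤ b →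
      ∃ p : Polynomial ℝ, p.degree < m ∧
        normL2 α β (fun x => g x - p.eval x) ≤ (β - α) ^ m * normL2 α β gm := by
  induction m generalizing g with
  | zero =>
    refine ⟨g, h.1, h.2, fun α β _ _ _ => ⟨0, ?_, ?_⟩⟩
    · rw [Polynomial.degree_zero]; exact WithBot.bot_lt_coe 0
    · simp
  | succ m ih =>
    obtain ⟨h1, g', h2, h3⟩ := h
    obtain ⟨gm, hgm, hgM, happ⟩ := ih h3
    refine ⟨gm, hgm, hgM, fun α β haα hαβ hβb => ?_⟩
    obtain ⟨p, hp, hpn⟩ := happ α β haα hαβ hβb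
    obtain ⟨P, hP1, hP2, hP3⟩ := exists_derivative_eq p α (g α)
    refine ⟨P, hP3 m hp, ?_⟩
    have hg' : MemL2 α β g' := h3.memL2.mono haα hβb
    have h4 : normL2 α β (fun x => g x - P.eval x)
        = normL2 α β (prim α (fun t => g' t - p.eval t)) := by
      refine normL2_congr hαβ ((ae_restrict_iff' measurableSet_Ioo).2 (ae_of_all _ fun y hy => ?_))
      have hy' : y ∈ Icc α β := ⟨hy.1.le, hy.2.le⟩
      have e1 := sub_eq_prim_of_subset haα hy.1.le (hy.2.le.trans hβb) h3.memL2 h2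
      have e2 := eval_eq_add_integral_derivative P α y
      rw [hP1, hP2] at e2
      have e3 := prim_sub hg' (memL2_polynomial p) hy'
      change g y - P.eval y = _
      rw [e3, e1, e2]
      simp only [prim]
      ring
    rw [h4, pow_succ', mul_assoc]
    exact (normL2_prim_le hαβ (hg'.sub (memL2_polynomial p))).trans
      (mul_le_mul_of_nonneg_left hpn (by linarith))

/-! ### Weak derivatives and primitives -/

section WeakDerivatives

variable {a b : ℝ}

theorem exists_test_integral_eq_one (hab : a < b) :
    ∃ η : ℝ → ℝ, ContDiff ℝ ((⊤ : ℕ∞) : WithTop ℕ∞) η ∧ HasCompactSupport η ∧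
      tsupport η ⊆ Ioo a b ∧ (tsupport η).Nonempty ∧ ∫ x in a..b, η x = 1 := by
  let B : ContDiffBump ((a + b) / 2) := ⟨(b - a) / 8, (b - a) / 4, by linarith, by linarith⟩
  have hts : tsupport (B.normed volume) = Metric.closedBall ((a + b) / 2) ((b - a) / 4) :=
    B.tsupport_normed_eq
  have hsub : tsupport (B.normed volume) ⊆ Ioo a b := by
    rw [hts, Real.closedBall_eq_Icc]
    exact fun x hx => ⟨by linarith [hx.1], by linarith [hx.2]⟩
  refine ⟨B.normed volume, B.contDiff_normed, B.hasCompactSupport_normed, hsub, ?_, ?_⟩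
  · rw [hts]; exact Metric.nonempty_closedBall.2 (by linarith)
  · rw [intervalIntegral.integral_eq_integral_of_support_subset]
    · exact B.integral_normed
    · exact (subset_tsupport _).trans (hsub.trans Ioo_subset_Ioc_self)

theorem eq_zero_of_tsupport_subset {φ : ℝ → ℝ} (h : tsupport φ ⊆ Ioo a b) {x : ℝ}
    (hx : x ∉ Ioo a b) : φ x = 0 :=
  image_eq_zero_of_notMem_tsupport fun h' => hx (h h')

/-- The primitive of a test function of mean zero is a test function. -/
theorem test_prim {θ : ℝ → ℝ} (hθ : ContDiff ℝ ((⊤ : ℕ∞) : WithTop ℕ∞) θ) {K : Set ℝ}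
    (hK : IsCompact K) (hKne : K.Nonempty) (hKs : K ⊆ Ioo a b) (hθK : ∀ x ∉ K, θ x = 0)
    (h0 : ∫ x in a..b, θ x = 0) :
    ContDiff ℝ ((⊤ : ℕ∞) : WithTop ℕ∞) (prim a θ) ∧ HasCompactSupport (prim a θ) ∧
      tsupport (prim a θ) ⊆ Ioo a b ∧ deriv (prim a θ) = θ := by
  have hd : ∀ x, HasDerivAt (prim a θ) (θ x) x := fun x =>
    intervalIntegral.integral_hasDerivAt_right (hθ.continuous.intervalIntegrable _ _)
      hθ.continuous.aestronglyMeasurable.stronglyMeasurableAtFilter hθ.continuous.continuousAt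
  have hdd : deriv (prim a θ) = θ := funext fun x => (hd x).deriv
  obtain ⟨α, hα⟩ := hK.exists_isLeast hKne
  obtain ⟨β, hβ⟩ := hK.exists_isGreatest hKne
  have hαI := hKs hα.1
  have hβI := hKs hβ.1
  have hz : ∀ x ∉ Icc α β, prim a θ x = 0 := by
    intro x hx
    rcases lt_or_ge x α with hxα | hxα
    -- Left of K the integrand is zero; right of K the mean-zero condition makes the integral from a
    -- to x vanish too.
    · refine intervalIntegral.integral_zero_ae (ae_of_all _ fun t ht => hθK t fun htK => ?_)
      have := hα.2 htK
      rcases uIoc_subset_uIcc ht with ⟨-, h2⟩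
      exact absurd (this.trans h2) (not_le.2 (max_lt hαI.1 hxα))
    · have hxβ : β < x := lt_of_not_ge fun h => hx ⟨hxα, h⟩
      have h1 : ∫ t in b..x, θ t = 0 := by
        refine intervalIntegral.integral_zero_ae (ae_of_all _ fun t ht => hθK t fun htK => ?_)
        have := hβ.2 htK
        rcases uIoc_subset_uIcc ht with ⟨h2, -⟩
        exact absurd (h2.trans this) (not_le.2 (lt_min hβI.2 hxβ))
      rw [prim, ← intervalIntegral.integral_add_adjacent_intervals
        (hθ.continuous.intervalIntegrable a b) (hθ.continuous.intervalIntegrable b x), h0, h1,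
        add_zero]
  refine ⟨contDiff_infty_iff_deriv.2 ⟨fun x => (hd x).differentiableAt, by rwa [hdd]⟩,
    HasCompactSupport.intro isCompact_Icc hz, ?_, hdd⟩
  refine (closure_minimal (fun x hx => ?_) isClosed_Icc).trans (Icc_subset_Ioo hαI.1 hβI.2)
  by_contra h
  exact hx (hz x h)

/-- The lemma of du Bois-Reymond. -/
theorem ae_eq_const_of_integral_mul_deriv (hab : a < b) {w : ℝ → ℝ}
    (hw : IntegrableOn w (Ioo a b))
    (h : ∀ φ : ℝ → ℝ, ContDiff ℝ ((⊤ : ℕ∞) : WithTop ℕ∞) φ → HasCompactSupport φ →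
      tsupport φ ⊆ Ioo a b → ∫ x in a..b, w x * deriv φ x = 0) :
    ∃ c : ℝ, w =ᵐ[volume.restrict (Ioo a b)] fun _ => c := by
  obtain ⟨η, hη, hηc, hηs, hηne, hη1⟩ := exists_test_integral_eq_one hab
  have hwi := intervalIntegrable_of_integrableOn_Ioo hab.le hw
  have hmul : ∀ ψ : ℝ → ℝ, Continuous ψ → IntervalIntegrable (fun x => w x * ψ x) volume a b :=
    fun ψ hψ => hwi.mul_continuousOn hψ.continuousOn
  set c := ∫ x in a..b, w x * η x with hc
  refine ⟨c, ?_⟩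
  have key : ∀ ψ : ℝ → ℝ, ContDiff ℝ ((⊤ : ℕ∞) : WithTop ℕ∞) ψ → HasCompactSupport ψ →
      tsupport ψ ⊆ Ioo a b → ∫ x, ψ x • (w x - c) = 0 := by
    intro ψ hψ hψc hψs
    set I := ∫ x in a..b, ψ x with hI
    -- Subtracting the multiple I of the normalized bump gives ψ mean zero, so it becomes the
    -- derivative of a test function.
    obtain ⟨h1, h2, h3, h4⟩ := test_prim (a := a) (b := b) (θ := fun x => ψ x - I * η x)
      (hψ.sub (contDiff_const.mul hη)) (hψc.isCompact.union hηc.isCompact)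
      (hηne.mono subset_union_right) (union_subset hψs hηs)
      (fun x hx => by
        rw [image_eq_zero_of_notMem_tsupport fun h' => hx (Or.inl h'),
          image_eq_zero_of_notMem_tsupport fun h' => hx (Or.inr h')]
        ring)
      (by
        rw [intervalIntegral.integral_sub (hψ.continuous.intervalIntegrable _ _)
          ((hη.continuous.intervalIntegrable _ _).const_mul I),
          intervalIntegral.integral_const_mul, hη1, ← hI]
        ring)
    have h5 := h _ h1 h2 h3
    rw [h4] at h5
    have h6 : ∀ x, w x * (ψ x - I * η x) = w x * ψ x - I * (w x * η x) := fun x => by ring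
    simp only [h6] at h5
    rw [intervalIntegral.integral_sub (hmul ψ hψ.continuous)
      ((hmul η hη.continuous).const_mul I), intervalIntegral.integral_const_mul, ← hc] at h5
    rw [← intervalIntegral.integral_eq_integral_of_support_subset (a := a) (b := b)]
    · have h7 : ∀ x, ψ x • (w x - c) = w x * ψ x - c * ψ x := fun x => by
        rw [smul_eq_mul]; ring
      simp only [h7]
      rw [intervalIntegral.integral_sub (hmul ψ hψ.continuous)
        ((hψ.continuous.intervalIntegrable _ _).const_mul c),
        intervalIntegral.integral_const_mul, ← hI]
      linarith
    · exact (Function.support_smul_subset_left _ _).trans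
        ((subset_tsupport _).trans (hψs.trans Ioo_subset_Ioc_self))
  have := isOpen_Ioo.ae_eq_zero_of_integral_contDiff_smul_eq_zero
    ((hw.sub (integrableOn_const (by simp))).locallyIntegrableOn) key
  rw [EventuallyEq, ae_restrict_iff' measurableSet_Ioo]
  filter_upwards [this] with x hx hxI
  have := hx hxI
  simp only [Pi.sub_apply] at this
  linarith

/-- The difference of u and the primitive of g annihilates every derivative of a test function,
hence is constant by du Bois-Reymond. -/
theorem HasWeakDeriv.exists_ae_eq_prim (hab : a < b) {u g : ℝ → ℝ} (h : HasWeakDeriv a b 1 u g)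
    (hu : IntegrableOn u (Ioo a b)) (hg : IntegrableOn g (Ioo a b)) :
    ∃ c : ℝ, u =ᵐ[volume.restrict (Ioo a b)] fun x => c + prim a g x := by
  have hgi := intervalIntegrable_of_integrableOn_Ioo hab.le hg
  have hui := intervalIntegrable_of_integrableOn_Ioo hab.le hu
  have hpc := continuousOn_prim hab.le hgi
  have hpi : IntervalIntegrable (prim a g) volume a b :=
    ContinuousOn.intervalIntegrable (by rwa [uIcc_of_le hab.le])
  have hw : IntegrableOn (fun x => u x - prim a g x) (Ioo a b) :=
    hu.sub ((hpc.integrableOn_Icc).mono_set Ioo_subset_Icc_self)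
  obtain ⟨c, hc⟩ := ae_eq_const_of_integral_mul_deriv hab hw fun φ hφ hφc hφs => by
    have h1 := h.2.2 φ hφ hφc hφs
    have hφ' : Continuous (deriv φ) := hφ.continuous_deriv (by simp)
    have hφd : ∀ x, HasDerivAt φ (deriv φ x) x := fun x =>
      (hφ.differentiable (by simp) x).hasDerivAt
    simp only [iteratedDeriv_one, pow_one] at h1
    have h2 := integral_primitive_mul hab.le (F := prim a g) (G := φ) hgi
      (hφ'.intervalIntegrable a b)
      (fun x _ => by simp [prim])
      (fun x _ => by
        rw [prim, intervalIntegral.integral_eq_sub_of_hasDerivAt (fun t _ => hφd t)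
          (hφ'.intervalIntegrable _ _)]
        ring)
    rw [eq_zero_of_tsupport_subset hφs (x := b) (by simp),
      eq_zero_of_tsupport_subset hφs (x := a) (by simp), intervalIntegral.integral_add
        (hgi.mul_continuousOn hφ.continuous.continuousOn)
        (hpi.mul_continuousOn hφ'.continuousOn)] at h2
    simp only [sub_mul]
    rw [intervalIntegral.integral_sub (hui.mul_continuousOn hφ'.continuousOn)
      (hpi.mul_continuousOn hφ'.continuousOn)]
    linarith
  exact ⟨c, hc.mono fun x hx => by simp only at hx; linarith⟩

/-- Lifts a good representative `v'` of the weak derivative to one of u. Changing g on a null set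
does not affect its primitive. -/
theorem HasWeakDeriv.exists_primitive (hab : a < b) {m : ℕ} {M : ℝ} {u g v' : ℝ → ℝ}
    (h : HasWeakDeriv a b 1 u g) (hu : MemL2 a b u) (huM : normL2 a b u ≤ M) (hg : MemL2 a b g)
    (hv' : v' =ᵐ[volume.restrict (Ioo a b)] g) (hb : SobolevBound a b m M v') :
    ∃ v : ℝ → ℝ, v =ᵐ[volume.restrict (Ioo a b)] u ∧ (∀ x, v x = v a + prim a v' x) ∧
      SobolevBound a b (m + 1) M v := by
  obtain ⟨c, hc⟩ := h.exists_ae_eq_prim hab hu.integrableOn hg.integrableOn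
  have hv : (fun x => c + prim a v' x) =ᵐ[volume.restrict (Ioo a b)] u := by
    refine EventuallyEq.trans ((ae_restrict_iff' measurableSet_Ioo).2 (ae_of_all _ fun x hx => ?_))
      hc.symm
    simp only [prim_congr hv' ⟨hx.1.le, hx.2.le⟩]
  refine ⟨_, hv, fun x => by simp [prim], ⟨memL2_congr hv.symm hu, ?_⟩, v',
    fun x _ => by simp [prim], hb⟩
  rwa [normL2_congr hab.le hv]

theorem exists_sobolevBound_of_chain (hab : a < b) {m : ℕ} {M : ℝ} (g : ℕ → ℝ → ℝ)
    (hd : ∀ j < m, HasWeakDeriv a b 1 (g j) (g (j + 1)))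
    (hg : ∀ j ≤ m, MemL2 a b (g j) ∧ normL2 a b (g j) ≤ M) :
    ∃ v : ℝ → ℝ, v =ᵐ[volume.restrict (Ioo a b)] g 0 ∧ SobolevBound a b m M v := by
  induction m generalizing g with
  | zero => exact ⟨g 0, EventuallyEq.rfl, hg 0 le_rfl⟩
  | succ m ih =>
    obtain ⟨v', hv', hb⟩ := ih (fun j => g (j + 1)) (fun j hj => hd (j + 1) (by omega))
      (fun j hj => hg (j + 1) (by omega))
    obtain ⟨v, hv, -, hvb⟩ := (hd 0 (by omega)).exists_primitive hab (hg 0 (by omega)).1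
      (hg 0 (by omega)).2 (hg 1 (by omega)).1 hv' hb
    exact ⟨v, hv, hvb⟩

theorem integrable_test_mul {φ g : ℝ → ℝ} (hφ : Continuous φ) (hφc : HasCompactSupport φ)
    (hφs : tsupport φ ⊆ Ioo a b) (hg : LocallyIntegrableOn g (Ioo a b)) :
    Integrable (fun x => φ x * g x) := by
  have h1 : IntegrableOn g (tsupport φ) := hg.integrableOn_compact_subset hφs hφc
  have h2 : IntegrableOn (fun x => φ x * g x) (tsupport φ) :=
    h1.continuousOn_mul hφ.continuousOn hφc
  refine (integrableOn_iff_integrable_of_support_subset ?_).1 h2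
  exact (Function.support_mul_subset_left _ _).trans (subset_tsupport _)

theorem ae_eq_of_integral_mul_test_eq {g₁ g₂ : ℝ → ℝ}
    (h₁ : LocallyIntegrableOn g₁ (Ioo a b)) (h₂ : LocallyIntegrableOn g₂ (Ioo a b))
    (h : ∀ φ : ℝ → ℝ, ContDiff ℝ ((⊤ : ℕ∞) : WithTop ℕ∞) φ → HasCompactSupport φ →
      tsupport φ ⊆ Ioo a b → ∫ x in a..b, g₁ x * φ x = ∫ x in a..b, g₂ x * φ x) :
    g₁ =ᵐ[volume.restrict (Ioo a b)] g₂ := by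
  have := isOpen_Ioo.ae_eq_zero_of_integral_contDiff_smul_eq_zero (h₁.sub h₂)
    fun φ hφ hφc hφs => by
      have h3 := h φ hφ hφc hφs
      have hsupp : ∀ g : ℝ → ℝ, Function.support (fun x => g x * φ x) ⊆ Ioc a b := fun g =>
        (Function.support_mul_subset_right _ _).trans
          ((subset_tsupport _).trans (hφs.trans Ioo_subset_Ioc_self))
      rw [intervalIntegral.integral_eq_integral_of_support_subset (hsupp _),
        intervalIntegral.integral_eq_integral_of_support_subset (hsupp _)] at h3
      simp only [Pi.sub_apply, smul_eq_mul, mul_sub]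
      rw [integral_sub (integrable_test_mul hφ.continuous hφc hφs h₁)
        (integrable_test_mul hφ.continuous hφc hφs h₂)]
      simp only [mul_comm (φ _), h3, sub_self]
  rw [EventuallyEq, ae_restrict_iff' measurableSet_Ioo]
  filter_upwards [this] with x hx hxI
  exact sub_eq_zero.1 (hx hxI)

theorem HasWeakDeriv.ae_unique {j : ℕ} {u g₁ g₂ : ℝ → ℝ} (h₁ : HasWeakDeriv a b j u g₁)
    (h₂ : HasWeakDeriv a b j u g₂) : g₁ =ᵐ[volume.restrict (Ioo a b)] g₂ :=
  ae_eq_of_integral_mul_test_eq h₁.2.1 h₂.2.1 fun φ hφ hφc hφs =>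
    mul_left_cancel₀ (pow_ne_zero j (by norm_num))
      ((h₁.2.2 φ hφ hφc hφs).symm.trans (h₂.2.2 φ hφ hφc hφs))

theorem HasWeakDeriv.ae_eq_of_zero {u g : ℝ → ℝ} (h : HasWeakDeriv a b 0 u g) :
    u =ᵐ[volume.restrict (Ioo a b)] g :=
  ae_eq_of_integral_mul_test_eq h.1 h.2.1 fun φ hφ hφc hφs => by
    simpa using h.2.2 φ hφ hφc hφs

/-- Test the definition of order j with φ': the hypotheses give derivatives of each order
separately, and this links consecutive ones. -/
theorem HasWeakDeriv.succ {j : ℕ} {u g g' : ℝ → ℝ} (h : HasWeakDeriv a b j u g)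
    (h' : HasWeakDeriv a b (j + 1) u g') : HasWeakDeriv a b 1 g g' := by
  refine ⟨h.2.1, h'.2.1, fun φ hφ hφc hφs => ?_⟩
  have h1 := h.2.2 (deriv φ) (contDiff_infty_iff_deriv.1 hφ).2 hφc.deriv
    (tsupport_deriv_subset.trans hφs)
  have h2 := h'.2.2 φ hφ hφc hφs
  rw [iteratedDeriv_succ', h1, pow_succ, mul_assoc] at h2
  rw [iteratedDeriv_one, pow_one]
  exact mul_left_cancel₀ (pow_ne_zero j (by norm_num)) h2

variable {m : ℕ} {u : ℝ → ℝ}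

theorem MemH.hasWeakDeriv_weakDeriv (h : MemH m a b u) {j : ℕ} (hj : j ≤ m) :
    HasWeakDeriv a b j u (weakDeriv a b j u) ∧ MemL2 a b (weakDeriv a b j u) := by
  obtain ⟨g, hg, hg2⟩ := h j hj
  have hex : ∃ g : ℝ → ℝ, HasWeakDeriv a b j u g := ⟨g, hg⟩
  have h1 : HasWeakDeriv a b j u (weakDeriv a b j u) := by
    rw [weakDeriv, dif_pos hex]
    exact hex.choose_spec
  exact ⟨h1, memL2_congr (hg.ae_unique h1) hg2⟩

theorem normL2_weakDeriv_le {j : ℕ} (hj : j ≤ m) :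
    normL2 a b (weakDeriv a b j u) ≤ normH m a b u := by
  apply Real.le_sqrt_of_sq_le
  exact Finset.single_le_sum (f := fun j => normL2 a b (weakDeriv a b j u) ^ 2)
    (fun _ _ => sq_nonneg _) (Finset.mem_range.2 (by omega))

theorem MemH.exists_sobolevBound (hab : a < b) (h : MemH m a b u) :
    ∃ v : ℝ → ℝ, v =ᵐ[volume.restrict (Ioo a b)] u ∧ SobolevBound a b m (normH m a b u) v := by
  obtain ⟨v, hv, hb⟩ := exists_sobolevBound_of_chain hab (fun j => weakDeriv a b j u)
    (fun j hj => (h.hasWeakDeriv_weakDeriv hj.le).1.succ (h.hasWeakDeriv_weakDeriv hj).1)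
    (fun j hj => ⟨(h.hasWeakDeriv_weakDeriv hj).2, normL2_weakDeriv_le hj⟩)
  exact ⟨v, hv.trans (h.hasWeakDeriv_weakDeriv (Nat.zero_le _)).1.ae_eq_of_zero.symm, hb⟩

/-- Representatives of u and u' are chosen together, so that one is the exact primitive of the other
and the same Sobolev norm bounds both. -/
theorem MemH.exists_sobolevBound_deriv (hab : a < b) (h : MemH (m + 1) a b u) {u' : ℝ → ℝ}
    (hu' : HasWeakDeriv a b 1 u u') :
    ∃ v v' : ℝ → ℝ, v =ᵐ[volume.restrict (Ioo a b)] u ∧ v' =ᵐ[volume.restrict (Ioo a b)] u' ∧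
      (∀ x, v x = v a + prim a v' x) ∧
      SobolevBound a b (m + 1) (normH (m + 1) a b u) v ∧
      SobolevBound a b m (normH (m + 1) a b u) v' := by
  obtain ⟨v', hv', hb⟩ := exists_sobolevBound_of_chain hab (m := m)
    (fun j => weakDeriv a b (j + 1) u)
    (fun j hj => (h.hasWeakDeriv_weakDeriv (by omega)).1.succ
      (h.hasWeakDeriv_weakDeriv (by omega)).1)
    (fun j hj => ⟨(h.hasWeakDeriv_weakDeriv (Nat.succ_le_succ hj)).2,
      normL2_weakDeriv_le (Nat.succ_le_succ hj)⟩)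
  have h0 := h.hasWeakDeriv_weakDeriv (Nat.zero_le _)
  have h1 := h.hasWeakDeriv_weakDeriv (Nat.le_add_left 1 m)
  have e0 := h0.1.ae_eq_of_zero
  obtain ⟨v, hv, hp, hvb⟩ := h1.1.exists_primitive hab (memL2_congr e0.symm h0.2)
    ((normL2_congr hab.le e0).trans_le (normL2_weakDeriv_le (Nat.zero_le _))) h1.2 hv' hb
  exact ⟨v, v', hv, hv'.trans (h1.1.ae_unique hu'), hp, hvb, hb⟩

theorem HasValueAt.eq_of_continuousOn (hab : a < b) {v : ℝ → ℝ} {x c : ℝ} (h : HasValueAt a b u x c)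
    (hv : ContinuousOn v (Icc a b)) (hvu : v =ᵐ[volume.restrict (Ioo a b)] u) (hx : x ∈ Icc a b) :
    v x = c := by
  obtain ⟨w, hw, hwu, rfl⟩ := h
  refine Measure.eqOn_Icc_of_ae_eq volume hab.ne ?_ hv hw hx
  rw [← restrict_Ioo_eq_restrict_Icc]
  exact hvu.trans hwu.symm

/-- The continuous functions max(c, v) and v agree almost everywhere, hence everywhere on the closed
interval. -/
theorem ae_le_imp_le_of_continuousOn (hab : a < b) {v : ℝ → ℝ} {c : ℝ}
    (hv : ContinuousOn v (Icc a b)) (h : ∀ᵐ x ∂(volume.restrict (Ioo a b)), c ≤ v x)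
    {x : ℝ} (hx : x ∈ Icc a b) : c ≤ v x := by
  have : EqOn (fun x => max c (v x)) v (Icc a b) := by
    refine Measure.eqOn_Icc_of_ae_eq volume hab.ne ?_ (continuousOn_const.sup hv) hv
    rw [← restrict_Ioo_eq_restrict_Icc]
    exact h.mono fun x hx => max_eq_right hx
  rw [← this hx]
  exact le_max_left _ _

end WeakDerivatives

/-! ### Piecewise polynomials -/

namespace Partition

variable {a b : ℝ} (T : Partition a b)

theorem le_lo (i : Fin (T.n + 1)) : a ≤ T.lo i := by
  conv_lhs => rw [← T.node_first]
  exact T.strictMono.monotone (Fin.zero_le _)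

theorem hi_le (i : Fin (T.n + 1)) : T.hi i ≤ b := by
  conv_rhs => rw [← T.node_last]
  exact T.strictMono.monotone (Fin.le_last _)

theorem hi_le_lo {i j : Fin (T.n + 1)} (h : i < j) : T.hi i ≤ T.lo j :=
  T.strictMono.monotone (Fin.succ_le_castSucc_iff.2 h)

theorem lo_zero : T.lo 0 = a := T.node_first

theorem lo_succ (i : Fin T.n) : T.lo i.succ = T.hi i.castSucc := rfl

theorem sub_le_meshSize (i : Fin (T.n + 1)) : T.hi i - T.lo i ≤ T.meshSize :=
  Finset.le_sup' (fun i : Fin (T.n + 1) => T.hi i - T.lo i) (Finset.mem_univ i)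

theorem meshSize_pos : 0 < T.meshSize :=
  (sub_pos.2 (T.lo_lt_hi 0)).trans_le (T.sub_le_meshSize 0)

theorem meshSize_le : T.meshSize ≤ b - a :=
  Finset.sup'_le _ _ fun i _ => sub_le_sub (T.hi_le i) (T.le_lo i)

theorem left_lt_right {a b : ℝ} (T : Partition a b) : a < b :=
  (T.le_lo 0).trans_lt ((T.lo_lt_hi 0).trans_le (T.hi_le 0))

theorem sum_integral {F : ℝ → ℝ} (hF : IntervalIntegrable F volume a b) :
    ∑ i, ∫ x in (T.lo i)..(T.hi i), F x = ∫ x in a..b, F x := by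
  -- Nodes extended to all natural indices, to use the telescoping lemma; the default b is never
  -- reached in the sum.
  let x : ℕ → ℝ := fun j => if h : j < T.n + 2 then T.node ⟨j, h⟩ else b
  have hlo : ∀ i : Fin (T.n + 1), T.lo i = x i := fun i => by
    simp only [x]
    rw [dif_pos (by omega)]
    rfl
  have hhi : ∀ i : Fin (T.n + 1), T.hi i = x (i + 1) := fun i => by
    simp only [x]
    rw [dif_pos (by omega)]
    rfl
  simp only [hlo, hhi]
  rw [Fin.sum_univ_eq_sum_range (fun j => ∫ t in (x j)..(x (j + 1)), F t),
    intervalIntegral.sum_integral_adjacent_intervals]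
  · have h0 : x 0 = a := (hlo 0).symm.trans T.lo_zero
    have h1 : x (T.n + 1) = b := (hhi (Fin.last _)).symm.trans T.node_last
    rw [h0, h1]
  · intro j hj
    have e1 := hlo ⟨j, hj⟩
    have e2 := hhi ⟨j, hj⟩
    simp only at e1 e2
    rw [← e1, ← e2]
    refine hF.mono_set ?_
    rw [uIcc_of_le (T.lo_lt_hi _).le, uIcc_of_le T.left_lt_right.le]
    exact Icc_subset_Icc (T.le_lo _) (T.hi_le _)

/-- The piecewise polynomial function with the given pieces (with value `0` at the nodes). -/
def pw (p : Fin (T.n + 1) → Polynomial ℝ) (x : ℝ) : ℝ :=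
  ∑ i, (Ioo (T.lo i) (T.hi i)).indicator (fun y => (p i).eval y) x

theorem pw_of_mem (p : Fin (T.n + 1) → Polynomial ℝ) (i : Fin (T.n + 1)) {x : ℝ}
    (hx : x ∈ Ioo (T.lo i) (T.hi i)) : T.pw p x = (p i).eval x := by
  rw [pw, Finset.sum_eq_single i _ (fun h => absurd (Finset.mem_univ i) h), indicator_of_mem hx]
  intro j _ hj
  refine indicator_of_notMem (fun hxj => ?_) _
  rcases lt_or_gt_of_ne hj with h | h
  · exact absurd (hxj.2.trans_le (T.hi_le_lo h)) (not_lt.2 hx.1.le)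
  · exact absurd (hx.2.trans_le (T.hi_le_lo h)) (not_lt.2 hxj.1.le)

theorem pw_sub (p q : Fin (T.n + 1) → Polynomial ℝ) (x : ℝ) :
    T.pw (fun i => p i - q i) x = T.pw p x - T.pw q x := by
  simp only [pw, indicator_apply, Polynomial.eval_sub, ← Finset.sum_sub_distrib]
  refine Finset.sum_congr rfl fun i _ => ?_
  split_ifs <;> simp

theorem memL2_pw (p : Fin (T.n + 1) → Polynomial ℝ) : MemL2 a b (T.pw p) := by
  have : MemLp (fun x => ∑ i, (Ioo (T.lo i) (T.hi i)).indicator (fun y => (p i).eval y) x) 2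
      (volume.restrict (Ioo a b)) :=
    memLp_finsetSum _ fun i _ => MemLp.indicator measurableSet_Ioo (memL2_polynomial (p i))
  exact this

theorem integral_element_pw (p : Fin (T.n + 1) → Polynomial ℝ) (F : ℝ → ℝ → ℝ)
    (i : Fin (T.n + 1)) : ∫ x in (T.lo i)..(T.hi i), F x (T.pw p x)
      = ∫ x in (T.lo i)..(T.hi i), F x ((p i).eval x) :=
  integral_congr_Ioo (T.lo_lt_hi i).le fun x hx => by rw [T.pw_of_mem p i hx]

theorem normL2_element_sub_pw (p : Fin (T.n + 1) → Polynomial ℝ) (g : ℝ → ℝ)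
    (i : Fin (T.n + 1)) : normL2 (T.lo i) (T.hi i) (fun x => g x - T.pw p x)
      = normL2 (T.lo i) (T.hi i) (fun x => g x - (p i).eval x) := by
  unfold normL2
  rw [T.integral_element_pw p (fun x y => (g x - y) ^ 2)]

theorem sum_normL2_sq {F : ℝ → ℝ} (hF : MemL2 a b F) :
    ∑ i, normL2 (T.lo i) (T.hi i) F ^ 2 = normL2 a b F ^ 2 := by
  rw [normL2_sq T.left_lt_right.le, ← T.sum_integral (hF.intervalIntegrable_sq T.left_lt_right.le)]
  exact Finset.sum_congr rfl fun i _ => normL2_sq (T.lo_lt_hi i).le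

/-- Squares of L_2 norms add over elements, so a local bound with a uniform factor becomes global
with no dependence on the number of elements. -/
theorem normL2_le_of_elementwise {F G : ℝ → ℝ} {c : ℝ} (hF : MemL2 a b F) (hG : MemL2 a b G)
    (hc : 0 ≤ c) (h : ∀ i, normL2 (T.lo i) (T.hi i) F ≤ c * normL2 (T.lo i) (T.hi i) G) :
    normL2 a b F ≤ c * normL2 a b G := by
  refine le_of_sq_le_sq ?_ (mul_nonneg hc normL2_nonneg)
  rw [mul_pow, ← T.sum_normL2_sq hF, ← T.sum_normL2_sq hG, Finset.mul_sum]
  refine Finset.sum_le_sum fun i _ => ?_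
  rw [← mul_pow]
  exact pow_le_pow_left₀ normL2_nonneg (h i) 2

theorem exists_pw_approx {m : ℕ} {M : ℝ} {g : ℝ → ℝ} (h : SobolevBound a b m M g) :
    ∃ p : Fin (T.n + 1) → Polynomial ℝ, (∀ i, (p i).degree < m) ∧
      normL2 a b (fun x => g x - T.pw p x) ≤ T.meshSize ^ m * M := by
  obtain ⟨gm, hgm, hgM, happ⟩ := h.exists_polynomial_approx
  choose p hp hpn using fun i => happ (T.lo i) (T.hi i) (T.le_lo i) (T.lo_lt_hi i).le (T.hi_le i)
  refine ⟨p, hp, ?_⟩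
  have hh := pow_nonneg T.meshSize_pos.le m
  refine (T.normL2_le_of_elementwise (h.memL2.sub (T.memL2_pw p)) hgm hh fun i => ?_).trans
    (mul_le_mul_of_nonneg_left hgM hh)
  rw [T.normL2_element_sub_pw]
  exact (hpn i).trans (mul_le_mul_of_nonneg_right
    (pow_le_pow_left₀ (sub_nonneg.2 (T.lo_lt_hi i).le) (T.sub_le_meshSize i) m) normL2_nonneg)

theorem normL2_sub_pw_const_le {g g' : ℝ → ℝ} (hg : MemL2 a b g) (hg' : MemL2 a b g')
    (h : ∀ x ∈ Icc a b, g x = g a + prim a g' x) :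
    normL2 a b (fun x => g x - T.pw (fun i => Polynomial.C (g (T.lo i))) x)
      ≤ T.meshSize * normL2 a b g' := by
  refine T.normL2_le_of_elementwise (hg.sub (T.memL2_pw _)) hg' T.meshSize_pos.le fun i => ?_
  rw [T.normL2_element_sub_pw]
  simp only [Polynomial.eval_C]
  exact (normL2_sub_const_le (T.le_lo i) (T.lo_lt_hi i).le (T.hi_le i) hg' h).trans
    (mul_le_mul_of_nonneg_right (T.sub_le_meshSize i) normL2_nonneg)

/-- The primitive of a piecewise polynomial, piece by piece. -/
theorem exists_prim_pw (ψ : Fin (T.n + 1) → Polynomial ℝ) :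
    ∃ P : Fin (T.n + 1) → Polynomial ℝ, (∀ i, (P i).derivative = ψ i) ∧
      (∀ i, ∀ m : ℕ, (ψ i).degree < m → (P i).degree < (m + 1 : ℕ)) ∧
      ∀ i, ∀ x ∈ Icc (T.lo i) (T.hi i), (P i).eval x = prim a (T.pw ψ) x := by
  choose P hP1 hP2 hP3 using fun i => exists_derivative_eq (ψ i) (T.lo i) (prim a (T.pw ψ) (T.lo i))
  refine ⟨P, hP1, hP3, fun i x hx => ?_⟩
  have h1 := eval_eq_add_integral_derivative (P i) (T.lo i) x
  rw [hP1, hP2] at h1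
  have h2 := sub_eq_prim_of_subset (g := prim a (T.pw ψ)) (T.le_lo i) hx.1
    (hx.2.trans (T.hi_le i)) (T.memL2_pw ψ) (fun x _ => by simp [prim])
  rw [h1, h2]
  congr 1
  exact (integral_congr_Ioo hx.1 fun t ht => T.pw_of_mem ψ i ⟨ht.1, ht.2.trans_le hx.2⟩).symm

/-- `z` is the elementwise `L_2` projection of `F` to polynomials of degree at most `k`. -/
def IsProj (k : ℕ) (F : ℝ → ℝ) (z : Fin (T.n + 1) → Polynomial ℝ) : Prop :=
  (∀ i, (z i).natDegree ≤ k) ∧ ∀ q : Fin (T.n + 1) → Polynomial ℝ, (∀ i, (q i).natDegree ≤ k) →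
    ∫ x in a..b, (F x - T.pw z x) * T.pw q x = 0

variable {T}

theorem isProj_of_elementwise {k : ℕ} {F : ℝ → ℝ} (hF : MemL2 a b F)
    {z : Fin (T.n + 1) → Polynomial ℝ} (hz : ∀ i, (z i).natDegree ≤ k)
    (h : ∀ i, ∀ q : Polynomial ℝ, q.natDegree ≤ k →
      ∫ x in (T.lo i)..(T.hi i), (F x - (z i).eval x) * q.eval x = 0) : T.IsProj k F z := by
  refine ⟨hz, fun q hq => ?_⟩
  rw [← T.sum_integral ((hF.sub (T.memL2_pw z)).intervalIntegrable_mul T.left_lt_right.le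
    (T.memL2_pw q))]
  refine Finset.sum_eq_zero fun i _ => ?_
  rw [← h i (q i) (hq i)]
  exact integral_congr_Ioo (T.lo_lt_hi i).le fun x hx => by
    rw [T.pw_of_mem z i hx, T.pw_of_mem q i hx]

/-- Best approximation: since y-z is orthogonal to F-z, ‖F-z‖² = (F-z, F-y). -/
theorem IsProj.normL2_sub_le {k : ℕ} {F : ℝ → ℝ} {z y : Fin (T.n + 1) → Polynomial ℝ}
    (h : T.IsProj k F z) (hF : MemL2 a b F) (hy : ∀ i, (y i).natDegree ≤ k) :
    normL2 a b (fun x => F x - T.pw z x) ≤ normL2 a b (fun x => F x - T.pw y x) := by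
  have hab := T.left_lt_right.le
  have h1 := h.2 (fun i => y i - z i) fun i =>
    (Polynomial.natDegree_sub_le _ _).trans (max_le (hy i) (h.1 i))
  have hFz := hF.sub (T.memL2_pw z)
  have hFy := hF.sub (T.memL2_pw y)
  have h2 : normL2 a b (fun x => F x - T.pw z x) ^ 2
      = ∫ x in a..b, (F x - T.pw z x) * (F x - T.pw y x) := by
    rw [normL2_sq hab, ← sub_eq_zero, ← h1, ← intervalIntegral.integral_sub
      (hFz.intervalIntegrable_sq hab) (hFz.intervalIntegrable_mul hab hFy)]
    refine intervalIntegral.integral_congr fun x _ => ?_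
    simp only [T.pw_sub]
    ring
  have h3 := (le_abs_self _).trans (abs_integral_mul_le hab hFz hFy)
  rw [← h2, pow_two] at h3
  rcases (normL2_nonneg (a := a) (b := b) (f := fun x => F x - T.pw z x)).eq_or_lt with h0 | h0
  · rw [← h0]; exact normL2_nonneg
  · exact le_of_mul_le_mul_left h3 h0

theorem IsProj.normL2_le {k : ℕ} {F : ℝ → ℝ} {z : Fin (T.n + 1) → Polynomial ℝ}
    (h : T.IsProj k F z) (hF : MemL2 a b F) : normL2 a b (T.pw z) ≤ normL2 a b F := by
  have hab := T.left_lt_right.le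
  have h2 : normL2 a b (T.pw z) ^ 2 = ∫ x in a..b, F x * T.pw z x := by
    rw [normL2_sq hab, eq_comm, ← sub_eq_zero, ← h.2 z h.1, ← intervalIntegral.integral_sub
      (hF.intervalIntegrable_mul hab (T.memL2_pw z)) ((T.memL2_pw z).intervalIntegrable_sq hab)]
    exact intervalIntegral.integral_congr fun x _ => by ring
  have h3 := (le_abs_self _).trans (abs_integral_mul_le hab hF (T.memL2_pw z))
  rw [← h2, pow_two] at h3
  rcases (normL2_nonneg (a := a) (b := b) (f := T.pw z)).eq_or_lt with h0 | h0
  · rw [← h0]; exact normL2_nonneg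
  · exact le_of_mul_le_mul_right h3 h0

theorem IsProj.normL2_sub_le_meshSize {k : ℕ} {F F' : ℝ → ℝ} {z : Fin (T.n + 1) → Polynomial ℝ}
    (h : T.IsProj k F z) (hF : MemL2 a b F) (hF' : MemL2 a b F')
    (hp : ∀ x ∈ Icc a b, F x = F a + prim a F' x) :
    normL2 a b (fun x => F x - T.pw z x) ≤ T.meshSize * normL2 a b F' :=
  (h.normL2_sub_le hF fun i => by simp).trans (T.normL2_sub_pw_const_le hF hF' hp)

theorem natDegree_le_iff_degree_lt {p : Polynomial ℝ} {k : ℕ} :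
    p.natDegree ≤ k ↔ p.degree < (k + 1 : ℕ) := by
  rw [Polynomial.degree_lt_iff_coeff_zero, Polynomial.natDegree_le_iff_coeff_eq_zero]
  rfl

/-- The primitive of a piecewise constant is piecewise linear, so for k ≥ 1 the projection
reproduces it. This is what removes the consistency error in the duality argument. -/
theorem IsProj.normL2_sub_eq_zero {k : ℕ} (hk : 1 ≤ k) {c : Fin (T.n + 1) → ℝ}
    {z : Fin (T.n + 1) → Polynomial ℝ}
    (h : T.IsProj k (prim a (T.pw fun i => Polynomial.C (c i))) z) :
    normL2 a b (fun x => prim a (T.pw fun i => Polynomial.C (c i)) x - T.pw z x) = 0 := by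
  have hF := memL2_prim T.left_lt_right.le (T.memL2_pw fun i => Polynomial.C (c i))
  obtain ⟨P, -, hP2, hP3⟩ := T.exists_prim_pw fun i => Polynomial.C (c i)
  refine le_antisymm ((h.normL2_sub_le hF (y := P) fun i => ?_).trans ?_) normL2_nonneg
  · exact (natDegree_le_iff_degree_lt.2 (hP2 i 1
      ((Polynomial.degree_C_le).trans_lt (by norm_num)))).trans hk
  · have := T.normL2_le_of_elementwise (hF.sub (T.memL2_pw P)) (hF.sub (T.memL2_pw P)) le_rfl
      fun i => by
        rw [T.normL2_element_sub_pw, zero_mul]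
        refine normL2_le_of_sq_le le_rfl (le_of_eq ?_)
        rw [integral_congr_Ioo (g := fun _ => 0) (T.lo_lt_hi i).le fun x hx => by
          rw [hP3 i x ⟨hx.1.le, hx.2.le⟩]; ring]
        simp
    simpa using this

end Partition

/-! ### The discrete weak derivative -/

section DiscreteWeakDeriv

variable {k : ℕ} {α β vα vβ : ℝ}

theorem integral_polynomial_derivative_mul (P q : Polynomial ℝ) :
    ∫ x in α..β, P.derivative.eval x * q.eval x
      = -(∫ x in α..β, P.eval x * q.derivative.eval x) + P.eval β * q.eval β
        - P.eval α * q.eval α := by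
  have h := eval_eq_add_integral_derivative (P * q) α β
  simp only [Polynomial.derivative_mul, Polynomial.eval_add, Polynomial.eval_mul] at h
  rw [intervalIntegral.integral_add (Continuous.intervalIntegrable (by fun_prop) _ _)
    (Continuous.intervalIntegrable (by fun_prop) _ _)] at h
  linarith

/-- If R' = P, the discrete weak derivative of degree k of R, taken with its true endpoint values,
is the L_2 projection of P; existence is thus already known. -/
theorem exists_polynomial_projection (k : ℕ) (h : α < β) (P : Polynomial ℝ) :
    ∃ z : Polynomial ℝ, z.natDegree ≤ k ∧ ∀ q : Polynomial ℝ, q.natDegree ≤ k →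
      ∫ x in α..β, z.eval x * q.eval x = ∫ x in α..β, P.eval x * q.eval x := by
  obtain ⟨R, rfl, -, -⟩ := exists_derivative_eq P α 0
  obtain ⟨z, ⟨hz, hzq⟩, -⟩ := existsUnique_discreteWeakDeriv k h R (R.eval α) (R.eval β)
  exact ⟨z, hz, fun q hq => (hzq q hq).trans (integral_polynomial_derivative_mul R q).symm⟩

/-- The definition sees the interior part only through its moments against q', of degree at most k.
Replacing P by its projection therefore leaves the weak derivative equal to P'. -/
theorem isDiscreteWeakDeriv_derivative {P z : Polynomial ℝ} (hP : P.derivative.natDegree ≤ k + 1)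
    (hz : ∀ q : Polynomial ℝ, q.natDegree ≤ k →
      ∫ x in α..β, z.eval x * q.eval x = ∫ x in α..β, P.eval x * q.eval x) :
    IsDiscreteWeakDeriv (k + 1) α β z (P.eval α) (P.eval β) P.derivative := by
  refine ⟨hP, fun q hq => ?_⟩
  rw [hz _ ((Polynomial.natDegree_derivative_le q).trans (by omega))]
  exact integral_polynomial_derivative_mul P q

theorem IsDiscreteWeakDeriv.integral_eq {v d : Polynomial ℝ}
    (h : IsDiscreteWeakDeriv (k + 1) α β v vα vβ d) : ∫ x in α..β, d.eval x = vβ - vα := by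
  simpa using h.2 1 (by simp)

/-- Converse of the previous fact: test with an antiderivative Q of q, which has degree at most k+1
and is admissible exactly because r = k+1. The boundary terms cancel, since P matches both endpoint
values. -/
theorem IsDiscreteWeakDeriv.projection {v P : Polynomial ℝ}
    (h : IsDiscreteWeakDeriv (k + 1) α β v vα vβ P.derivative) (hα : P.eval α = vα)
    {q : Polynomial ℝ} (hq : q.natDegree ≤ k) :
    ∫ x in α..β, v.eval x * q.eval x = ∫ x in α..β, P.eval x * q.eval x := by
  obtain ⟨Q, rfl, -, hQ⟩ := exists_derivative_eq q α 0
  have h1 := h.2 Q (Partition.natDegree_le_iff_degree_lt.2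
    (hQ _ (Partition.natDegree_le_iff_degree_lt.1 hq)))
  rw [integral_polynomial_derivative_mul] at h1
  have hβ : P.eval β = vβ := by
    have := eval_eq_add_integral_derivative P α β
    rw [h.integral_eq] at this
    linarith
  rw [hα, hβ] at h1
  linarith

end DiscreteWeakDeriv

/-! ### The weak finite element space described by its discrete weak derivatives -/

namespace WeakFunction

variable {a b : ℝ} {T : Partition a b} {k : ℕ}

theorem isDiscreteWeakDeriv_dw (r : ℕ) (v : WeakFunction T k) (i : Fin (T.n + 1)) :
    IsDiscreteWeakDeriv r (T.lo i) (T.hi i) (v.interior i) (v.left i) (v.right i) (v.dw r i) :=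
  (existsUnique_discreteWeakDeriv r (T.lo_lt_hi i) (v.interior i) (v.left i)
    (v.right i)).choose_spec.1

theorem dw_eq {r : ℕ} {v : WeakFunction T k} {i : Fin (T.n + 1)} {d : Polynomial ℝ}
    (h : IsDiscreteWeakDeriv r (T.lo i) (T.hi i) (v.interior i) (v.left i) (v.right i) d) :
    v.dw r i = d :=
  ((existsUnique_discreteWeakDeriv r (T.lo_lt_hi i) (v.interior i) (v.left i)
    (v.right i)).choose_spec.2 d h).symm

/-- Testing with q = 1 gives the increment of v over each element as the integral of its weak
derivative; single-valuedness at the nodes and v(a) = 0 let the increments telescope. -/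
theorem left_eq_prim {v : WeakFunction T k} (hv : v ∈ weakFESpace T k) (i : Fin (T.n + 1)) :
    v.left i = prim a (T.pw (v.dw (k + 1))) (T.lo i) := by
  induction i using Fin.induction with
  | zero => rw [hv.1, T.lo_zero, prim, intervalIntegral.integral_same]
  | succ i ih =>
    have h1 := sub_eq_prim_of_subset (g := prim a (T.pw (v.dw (k + 1)))) (T.le_lo i.castSucc)
      (T.lo_lt_hi i.castSucc).le (T.hi_le i.castSucc) (T.memL2_pw (v.dw (k + 1)))
      (fun x _ => by simp [prim])
    have h2 : prim (T.lo i.castSucc) (T.pw (v.dw (k + 1))) (T.hi i.castSucc)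
        = v.right i.castSucc - v.left i.castSucc :=
      (T.integral_element_pw _ (fun _ y => y) _).trans (v.isDiscreteWeakDeriv_dw _ _).integral_eq
    have h3 := hv.2 i
    rw [jump] at h3
    rw [T.lo_succ, h1, h2, ← ih]
    linarith

theorem isProj_interior {v : WeakFunction T k} (hv : v ∈ weakFESpace T k) :
    T.IsProj k (prim a (T.pw (v.dw (k + 1)))) v.interior := by
  obtain ⟨P, hP1, -, hP3⟩ := T.exists_prim_pw (v.dw (k + 1))
  refine Partition.isProj_of_elementwise (memL2_prim T.left_lt_right.le (T.memL2_pw _))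
    v.natDegree_le fun i q hq => ?_
  have hd := v.isDiscreteWeakDeriv_dw (k + 1) i
  rw [← hP1 i] at hd
  have hα : (P i).eval (T.lo i) = v.left i := by
    rw [left_eq_prim hv, hP3 i _ ⟨le_rfl, (T.lo_lt_hi i).le⟩]
  have h1 := hd.projection hα hq
  rw [integral_congr_Ioo (g := fun x => (P i).eval x * q.eval x - (v.interior i).eval x * q.eval x)
    (T.lo_lt_hi i).le fun x hx => by rw [hP3 i x ⟨hx.1.le, hx.2.le⟩]; ring,
    intervalIntegral.integral_sub (Continuous.intervalIntegrable (by fun_prop) _ _)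
    (Continuous.intervalIntegrable (by fun_prop) _ _), h1, sub_self]

/-- The discrete weak derivative maps the weak finite element space onto the piecewise polynomials
of degree at most `k + 1`. -/
theorem exists_dw_eq {ψ : Fin (T.n + 1) → Polynomial ℝ} (hψ : ∀ i, (ψ i).natDegree ≤ k + 1) :
    ∃ v ∈ weakFESpace T k, v.dw (k + 1) = ψ := by
  obtain ⟨P, hP1, -, hP3⟩ := T.exists_prim_pw ψ
  choose z hz hzq using fun i => exists_polynomial_projection k (T.lo_lt_hi i) (P i)
  refine ⟨⟨z, hz, fun i => (P i).eval (T.lo i), fun i => (P i).eval (T.hi i)⟩, ⟨?_, fun i => ?_⟩,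
    funext fun i => dw_eq ?_⟩
  · change (P 0).eval (T.lo 0) = 0
    rw [hP3 0 _ ⟨le_rfl, (T.lo_lt_hi 0).le⟩, T.lo_zero, prim, intervalIntegral.integral_same]
  · change (P i.succ).eval (T.lo i.succ) - (P i.castSucc).eval (T.hi i.castSucc) = 0
    rw [hP3 _ _ ⟨le_rfl, (T.lo_lt_hi _).le⟩, hP3 _ _ ⟨(T.lo_lt_hi _).le, le_rfl⟩, T.lo_succ,
      sub_self]
  · rw [← hP1 i]
    exact isDiscreteWeakDeriv_derivative (by rw [hP1]; exact hψ i) (hzq i)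

end WeakFunction

/-- Restates the method with an arbitrary piecewise polynomial ψ as test derivative, the interior
test function being the projection of its primitive. -/
theorem IsWeakFESolution.exists_test {a b : ℝ} {T : Partition a b} {k : ℕ} {a₂ a₀ f : ℝ → ℝ}
    {uh : WeakFunction T k} (h : IsWeakFESolution T k (k + 1) a₂ a₀ f uh)
    (ha₂ : ∀ p : Fin (T.n + 1) → Polynomial ℝ, MemL2 a b (fun x => a₂ x * T.pw p x))
    {ψ : Fin (T.n + 1) → Polynomial ℝ} (hψ : ∀ i, (ψ i).natDegree ≤ k + 1) :
    ∃ z : Fin (T.n + 1) → Polynomial ℝ, T.IsProj k (prim a (T.pw ψ)) z ∧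
      (∫ x in a..b, a₂ x * T.pw (uh.dw (k + 1)) x * T.pw ψ x)
        + (∫ x in a..b, a₀ x * uh.interiorFun x * T.pw z x) = ∫ x in a..b, f x * T.pw z x := by
  obtain ⟨v, hv, rfl⟩ := WeakFunction.exists_dw_eq (T := T) hψ
  refine ⟨v.interior, WeakFunction.isProj_interior hv, ?_⟩
  change _ = ∫ x in a..b, f x * v.interiorFun x
  rw [← h.2 v hv, ← T.sum_integral ((ha₂ _).intervalIntegrable_mul T.left_lt_right.le
    (T.memL2_pw _))]
  congr 1
  refine Finset.sum_congr rfl fun i _ => integral_congr_Ioo (T.lo_lt_hi i).le fun x hx => ?_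
  rw [T.pw_of_mem _ i hx, T.pw_of_mem _ i hx]

/-! ### The duality argument -/

/-- Bounds for the coefficients of the boundary value problem; `a₂` is the continuous
representative, with derivative `a₂'`. -/
structure CoefficientBounds (a b amin A₂ D₂ A₀ : ℝ) (a₂ a₂' a₀ : ℝ → ℝ) : Prop where
  lt : a < b
  amin_pos : 0 < amin
  amin_le : ∀ x ∈ Icc a b, amin ≤ a₂ x
  a₂_le : ∀ x ∈ Icc a b, a₂ x ≤ A₂
  eq_prim : ∀ x ∈ Icc a b, a₂ x = a₂ a + prim a a₂' x
  memL2_deriv : MemL2 a b a₂'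
  norm_deriv_le : normL2 a b a₂' ≤ D₂
  measurable : AEStronglyMeasurable a₀ (volume.restrict (Ioo a b))
  a₀_nonneg : ∀ᵐ x ∂(volume.restrict (Ioo a b)), 0 ≤ a₀ x
  a₀_le : ∀ᵐ x ∂(volume.restrict (Ioo a b)), a₀ x ≤ A₀

theorem ae_Ioo_of_forall_Icc {a b : ℝ} {P : ℝ → Prop} (h : ∀ x ∈ Icc a b, P x) :
    ∀ᵐ x ∂(volume.restrict (Ioo a b)), P x :=
  (ae_restrict_iff' measurableSet_Ioo).2 (ae_of_all _ fun x hx => h x ⟨hx.1.le, hx.2.le⟩)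

theorem MemL2.abs {a b : ℝ} {f : ℝ → ℝ} (hf : MemL2 a b f) : MemL2 a b (fun x => |f x|) :=
  MemLp.abs hf

theorem normL2_abs {a b : ℝ} {f : ℝ → ℝ} : normL2 a b (fun x => |f x|) = normL2 a b f := by
  simp only [normL2, sq_abs]

theorem integral_sub_mul {a b : ℝ} (hab : a ≤ b) {f₁ f₂ g : ℝ → ℝ} (h₁ : MemL2 a b f₁)
    (h₂ : MemL2 a b f₂) (hg : MemL2 a b g) : ∫ x in a..b, (f₁ x - f₂ x) * g x
      = (∫ x in a..b, f₁ x * g x) - ∫ x in a..b, f₂ x * g x := by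
  simp only [sub_mul]
  exact intervalIntegral.integral_sub (h₁.intervalIntegrable_mul hab hg)
    (h₂.intervalIntegrable_mul hab hg)

theorem integral_mul_sub {a b : ℝ} (hab : a ≤ b) {f g₁ g₂ : ℝ → ℝ} (hf : MemL2 a b f)
    (h₁ : MemL2 a b g₁) (h₂ : MemL2 a b g₂) : ∫ x in a..b, f x * (g₁ x - g₂ x)
      = (∫ x in a..b, f x * g₁ x) - ∫ x in a..b, f x * g₂ x := by
  simp only [mul_sub]
  exact intervalIntegral.integral_sub (hf.intervalIntegrable_mul hab h₁)
    (hf.intervalIntegrable_mul hab h₂)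

namespace CoefficientBounds

variable {a b amin A₂ D₂ A₀ : ℝ} {a₂ a₂' a₀ : ℝ → ℝ}

section

variable (hc : CoefficientBounds a b amin A₂ D₂ A₀ a₂ a₂' a₀)
include hc

theorem A₂_nonneg : 0 ≤ A₂ :=
  hc.amin_pos.le.trans ((hc.amin_le a ⟨le_rfl, hc.lt.le⟩).trans (hc.a₂_le a ⟨le_rfl, hc.lt.le⟩))

theorem A₀_nonneg : 0 ≤ A₀ := by
  have : (ae (volume.restrict (Ioo a b))).NeBot := by
    rw [ae_neBot, Ne, Measure.restrict_eq_zero, Real.volume_Ioo]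
    simpa using hc.lt
  obtain ⟨x, h1, h2⟩ := (hc.a₀_nonneg.and hc.a₀_le).exists
  exact h1.trans h2

theorem D₂_nonneg : 0 ≤ D₂ := normL2_nonneg.trans hc.norm_deriv_le

theorem continuousOn : ContinuousOn a₂ (Icc a b) :=
  (continuousOn_const.add (continuousOn_prim hc.lt.le
    (hc.memL2_deriv.intervalIntegrable hc.lt.le))).congr hc.eq_prim

theorem a₂_pos {x : ℝ} (hx : x ∈ Icc a b) : 0 < a₂ x := hc.amin_pos.trans_le (hc.amin_le x hx)

theorem abs_a₂_le : ∀ᵐ x ∂(volume.restrict (Ioo a b)), |a₂ x| ≤ A₂ :=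
  ae_Ioo_of_forall_Icc fun x hx => by
    rw [abs_of_pos (hc.a₂_pos hx)]
    exact hc.a₂_le x hx

theorem abs_a₀_le : ∀ᵐ x ∂(volume.restrict (Ioo a b)), |a₀ x| ≤ A₀ := by
  filter_upwards [hc.a₀_nonneg, hc.a₀_le] with x h1 h2
  rwa [abs_of_nonneg h1]

theorem memL2_a₂_mul {g : ℝ → ℝ} (hg : MemL2 a b g) : MemL2 a b (fun x => a₂ x * g x) :=
  hg.bdd_mul (memL2_of_continuousOn hc.continuousOn).1 hc.abs_a₂_le

theorem memL2_a₀_mul {g : ℝ → ℝ} (hg : MemL2 a b g) : MemL2 a b (fun x => a₀ x * g x) :=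
  hg.bdd_mul hc.measurable hc.abs_a₀_le

theorem normL2_a₂_mul_le {g : ℝ → ℝ} (hg : MemL2 a b g) :
    normL2 a b (fun x => a₂ x * g x) ≤ A₂ * normL2 a b g :=
  normL2_bdd_mul_le hc.lt.le hg hc.A₂_nonneg hc.abs_a₂_le

theorem normL2_a₀_mul_le {g : ℝ → ℝ} (hg : MemL2 a b g) :
    normL2 a b (fun x => a₀ x * g x) ≤ A₀ * normL2 a b g :=
  normL2_bdd_mul_le hc.lt.le hg hc.A₀_nonneg hc.abs_a₀_le

theorem amin_mul_normL2_sq_le {g : ℝ → ℝ} (hg : MemL2 a b g) :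
    amin * normL2 a b g ^ 2 ≤ ∫ x in a..b, a₂ x * g x * g x := by
  rw [normL2_sq hc.lt.le, ← intervalIntegral.integral_const_mul]
  refine intervalIntegral.integral_mono_on hc.lt.le
    ((hg.intervalIntegrable_sq hc.lt.le).const_mul _)
    ((hc.memL2_a₂_mul hg).intervalIntegrable_mul hc.lt.le hg) fun x hx => ?_
  have := mul_le_mul_of_nonneg_right (hc.amin_le x hx) (sq_nonneg (g x))
  linarith

theorem integral_a₀_mul_nonneg (g : ℝ → ℝ) : 0 ≤ ∫ x in a..b, a₀ x * g x * g x := by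
  rw [intervalIntegral.integral_of_le hc.lt.le, integral_Ioc_eq_integral_Ioo]
  exact integral_nonneg_of_ae (hc.a₀_nonneg.mono fun x hx => by
    simp only [Pi.zero_apply, mul_assoc]
    exact mul_nonneg hx (mul_self_nonneg _))

/-- Pointwise a₀² ≤ A₀ a₀. Only the weighted quantity (a₀g, g) is controlled later, and a₀ may
vanish. -/
theorem normL2_a₀_mul_sq_le {g : ℝ → ℝ} (hg : MemL2 a b g) :
    normL2 a b (fun x => a₀ x * g x) ^ 2 ≤ A₀ * ∫ x in a..b, a₀ x * g x * g x := by
  have hag := hc.memL2_a₀_mul hg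
  rw [normL2_sq hc.lt.le, ← intervalIntegral.integral_const_mul,
    intervalIntegral.integral_of_le hc.lt.le, intervalIntegral.integral_of_le hc.lt.le,
    integral_Ioc_eq_integral_Ioo, integral_Ioc_eq_integral_Ioo]
  refine integral_mono_ae ?_ ?_ ?_
  · exact (intervalIntegrable_iff_integrableOn_Ioo_of_le hc.lt.le).1
      (hag.intervalIntegrable_sq hc.lt.le)
  · exact (intervalIntegrable_iff_integrableOn_Ioo_of_le hc.lt.le).1
      ((hag.intervalIntegrable_mul hc.lt.le hg).const_mul A₀)
  · filter_upwards [hc.a₀_nonneg, hc.a₀_le] with x h1 h2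
    have := mul_le_mul_of_nonneg_right h2 (mul_nonneg h1 (sq_nonneg (g x)))
    linarith

end

/-- The flux `∫_x^b g` of the dual problem. -/
def dualFlux (a b : ℝ) (g : ℝ → ℝ) (x : ℝ) : ℝ := prim a g b - prim a g x

/-- The derivative of the solution of the dual problem `-(a₂ w')' = g`, `w(a) = 0`, `w'(b) = 0`. -/
def dualDeriv (a b : ℝ) (a₂ g : ℝ → ℝ) (x : ℝ) : ℝ := dualFlux a b g x / a₂ x

variable {g : ℝ → ℝ}

theorem dualFlux_eq_prim (x : ℝ) :
    dualFlux a b g x = dualFlux a b g a + prim a (fun t => -g t) x := by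
  simp only [dualFlux, prim, intervalIntegral.integral_same, intervalIntegral.integral_neg]
  ring

theorem continuousOn_dualFlux (hab : a < b) (hg : MemL2 a b g) :
    ContinuousOn (dualFlux a b g) (Icc a b) :=
  continuousOn_const.sub (continuousOn_prim hab.le (hg.intervalIntegrable hab.le))

theorem abs_dualFlux_le (hg : MemL2 a b g) {x : ℝ} (hx : x ∈ Icc a b) :
    |dualFlux a b g x| ≤ Real.sqrt (b - a) * normL2 a b g := by
  have h1 : dualFlux a b g x = prim x g b := by
    have := sub_eq_prim_of_subset (g := prim a g) hx.1 hx.2 le_rfl hg (fun x _ => by simp [prim])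
    rw [dualFlux, this]
    ring
  rw [h1]
  exact (abs_prim_le (hg.mono hx.1 le_rfl) ⟨hx.2, le_rfl⟩).trans
    (mul_le_mul (Real.sqrt_le_sqrt (by linarith [hx.1]))
    (normL2_le_normL2_of_subset hx.1 hx.2 le_rfl hg) normL2_nonneg (Real.sqrt_nonneg _))

/-- Integration by parts; the flux vanishes at b and the primitive at a, so no boundary term
remains. -/
theorem integral_mul_prim (hab : a < b) (hg : MemL2 a b g) {φ : ℝ → ℝ} (hφ : MemL2 a b φ) :
    ∫ x in a..b, g x * prim a φ x = ∫ x in a..b, dualFlux a b g x * φ x := by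
  have h := integral_primitive_mul hab.le (hg.neg.intervalIntegrable hab.le)
    (hφ.intervalIntegrable hab.le) (fun x _ => dualFlux_eq_prim (g := g) (b := b) x)
    (G := prim a φ) (fun x _ => by simp [prim])
  rw [intervalIntegral.integral_add (hg.neg.intervalIntegrable_mul hab.le (memL2_prim hab.le hφ))
    ((memL2_of_continuousOn (continuousOn_dualFlux hab hg)).intervalIntegrable_mul hab.le hφ)] at h
  have h0 : dualFlux a b g b = 0 := sub_self _
  have h1 : prim a φ a = 0 := intervalIntegral.integral_same
  simp only [neg_mul, intervalIntegral.integral_neg, h0, h1] at h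
  linarith

variable (hc : CoefficientBounds a b amin A₂ D₂ A₀ a₂ a₂' a₀)
include hc

theorem continuousOn_dualDeriv (hg : MemL2 a b g) :
    ContinuousOn (dualDeriv a b a₂ g) (Icc a b) :=
  (continuousOn_dualFlux hc.lt hg).div hc.continuousOn fun _ hx => (hc.a₂_pos hx).ne'

theorem memL2_dualDeriv (hg : MemL2 a b g) : MemL2 a b (dualDeriv a b a₂ g) :=
  memL2_of_continuousOn (hc.continuousOn_dualDeriv hg)

theorem a₂_mul_dualDeriv {x : ℝ} (hx : x ∈ Icc a b) :
    a₂ x * dualDeriv a b a₂ g x = dualFlux a b g x :=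
  mul_div_cancel₀ _ (hc.a₂_pos hx).ne'

theorem integral_mul_prim_eq (hg : MemL2 a b g) {φ : ℝ → ℝ} (hφ : MemL2 a b φ) :
    ∫ x in a..b, g x * prim a φ x = ∫ x in a..b, a₂ x * φ x * dualDeriv a b a₂ g x := by
  rw [integral_mul_prim hc.lt hg hφ]
  refine integral_congr_Ioo hc.lt.le fun x hx => ?_
  rw [← hc.a₂_mul_dualDeriv ⟨hx.1.le, hx.2.le⟩]
  ring

theorem normL2_dualDeriv_le (hg : MemL2 a b g) :
    normL2 a b (dualDeriv a b a₂ g) ≤ (b - a) / amin * normL2 a b g := by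
  have hL : 0 ≤ b - a := sub_nonneg.2 hc.lt.le
  have h := normL2_le_of_abs_le (f := dualDeriv a b a₂ g) hc.lt.le
    (div_nonneg (mul_nonneg (Real.sqrt_nonneg (b - a)) (normL2_nonneg (f := g))) hc.amin_pos.le)
    fun x hx => by
      have hx' : x ∈ Icc a b := ⟨hx.1.le, hx.2.le⟩
      rw [dualDeriv, abs_div, abs_of_pos (hc.a₂_pos hx')]
      exact div_le_div₀ (mul_nonneg (Real.sqrt_nonneg _) normL2_nonneg) (abs_dualFlux_le hg hx')
        hc.amin_pos (hc.amin_le x hx')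
  refine h.trans_eq ?_
  calc _ = Real.sqrt (b - a) * Real.sqrt (b - a) / amin * normL2 a b g := by ring
    _ = _ := by rw [Real.mul_self_sqrt hL]

theorem normL2_prim_dualDeriv_le (hg : MemL2 a b g) :
    normL2 a b (prim a (dualDeriv a b a₂ g)) ≤ (b - a) ^ 2 / amin * normL2 a b g :=
  (normL2_prim_le hc.lt.le (hc.memL2_dualDeriv hg)).trans
    ((mul_le_mul_of_nonneg_left (hc.normL2_dualDeriv_le hg) (sub_nonneg.2 hc.lt.le)).trans_eq
      (by ring))

/-- Positivity of the dual solution operator g ↦ w: (g, w) = (a₂w', w'). -/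
theorem integral_mul_prim_dualDeriv_nonneg (hg : MemL2 a b g) :
    0 ≤ ∫ x in a..b, g x * prim a (dualDeriv a b a₂ g) x := by
  rw [hc.integral_mul_prim_eq hg (hc.memL2_dualDeriv hg)]
  exact (mul_nonneg hc.amin_pos.le (sq_nonneg _)).trans
    (hc.amin_mul_normL2_sq_le (hc.memL2_dualDeriv hg))

/-- Piecewise constant approximation of the derivative of the dual solution. -/
theorem exists_pw_const_dualDeriv (T : Partition a b) (hg : MemL2 a b g) :
    ∃ c : Fin (T.n + 1) → ℝ,
      normL2 a b (fun x => dualDeriv a b a₂ g x - T.pw (fun i => Polynomial.C (c i)) x)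
        ≤ (1 / amin + Real.sqrt (b - a) * D₂ / amin ^ 2) * T.meshSize * normL2 a b g := by
  have hab := hc.lt.le
  have hm := hc.amin_pos
  set Gc := T.pw (fun i => Polynomial.C (dualFlux a b g (T.lo i))) with hGc
  set Ac := T.pw (fun i => Polynomial.C (a₂ (T.lo i))) with hAc
  have hG := memL2_of_continuousOn (continuousOn_dualFlux hc.lt hg)
  have hA := memL2_of_continuousOn hc.continuousOn
  have h1 : normL2 a b (fun x => dualFlux a b g x - Gc x) ≤ T.meshSize * normL2 a b g := by
    have := T.normL2_sub_pw_const_le hG hg.neg fun x _ => dualFlux_eq_prim x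
    rwa [normL2_neg] at this
  have h2 : normL2 a b (fun x => a₂ x - Ac x) ≤ T.meshSize * D₂ :=
    (T.normL2_sub_pw_const_le hA hc.memL2_deriv hc.eq_prim).trans
      (mul_le_mul_of_nonneg_left hc.norm_deriv_le T.meshSize_pos.le)
  set κ := Real.sqrt (b - a) * normL2 a b g with hκ
  have hκ0 : 0 ≤ κ := mul_nonneg (Real.sqrt_nonneg _) normL2_nonneg
  refine ⟨fun i => dualFlux a b g (T.lo i) / a₂ (T.lo i), ?_⟩
  set W := T.pw (fun i => Polynomial.C (dualFlux a b g (T.lo i) / a₂ (T.lo i))) with hW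
  have hd1 := hG.sub (T.memL2_pw fun i => Polynomial.C (dualFlux a b g (T.lo i)))
  have hd2 := hA.sub (T.memL2_pw fun i => Polynomial.C (a₂ (T.lo i)))
  have hpt : ∀ i, ∀ x ∈ Ioo (T.lo i) (T.hi i), |dualDeriv a b a₂ g x - W x|
      ≤ 1 / amin * |dualFlux a b g x - Gc x| + κ / amin ^ 2 * |a₂ x - Ac x| := by
    intro i x hx
    have hlo : T.lo i ∈ Icc a b := ⟨T.le_lo i, (T.lo_lt_hi i).le.trans (T.hi_le i)⟩
    have hx' : x ∈ Icc a b := ⟨(T.le_lo i).trans hx.1.le, hx.2.le.trans (T.hi_le i)⟩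
    rw [hW, hGc, hAc, T.pw_of_mem _ i hx, T.pw_of_mem _ i hx, T.pw_of_mem _ i hx]
    simp only [Polynomial.eval_C]
    have p1 := hc.a₂_pos hlo
    have p2 := hc.a₂_pos hx'
    -- Difference of two quotients split into a flux difference and a coefficient difference; both
    -- are of order h, since flux and coefficient are primitives of L_2 functions.
    have e1 : dualDeriv a b a₂ g x - dualFlux a b g (T.lo i) / a₂ (T.lo i)
        = 1 / a₂ x * (dualFlux a b g x - dualFlux a b g (T.lo i))
          - dualFlux a b g (T.lo i) / (a₂ (T.lo i) * a₂ x) * (a₂ x - a₂ (T.lo i)) := by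
      rw [dualDeriv]
      field_simp
      ring
    have e2 : |1 / a₂ x| ≤ 1 / amin := by
      rw [abs_of_pos (one_div_pos.2 p2)]
      exact one_div_le_one_div_of_le hm (hc.amin_le x hx')
    have e3 : |dualFlux a b g (T.lo i) / (a₂ (T.lo i) * a₂ x)| ≤ κ / amin ^ 2 := by
      rw [abs_div, abs_of_pos (mul_pos p1 p2), pow_two]
      exact div_le_div₀ hκ0 (abs_dualFlux_le hg hlo) (mul_pos hm hm)
        (mul_le_mul (hc.amin_le _ hlo) (hc.amin_le _ hx') hm.le p1.le)
    rw [e1]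
    refine (abs_sub _ _).trans ?_
    rw [abs_mul, abs_mul]
    exact add_le_add (mul_le_mul_of_nonneg_right e2 (abs_nonneg _))
      (mul_le_mul_of_nonneg_right e3 (abs_nonneg _))
  have hH1 := hd1.abs.const_mul (1 / amin)
  have hH2 := hd2.abs.const_mul (κ / amin ^ 2)
  have hH := hH1.add hH2
  have hle := T.normL2_le_of_elementwise ((hc.memL2_dualDeriv hg).sub (T.memL2_pw _)) hH zero_le_one
    fun i => by
      rw [one_mul]
      refine normL2_mono (T.lo_lt_hi i).le (hH.mono (T.le_lo i) (T.hi_le i))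
        ((ae_restrict_iff' measurableSet_Ioo).2 (ae_of_all _ fun x hx => ?_))
      exact (hpt i x hx).trans (le_abs_self _)
  rw [one_mul] at hle
  refine hle.trans ((normL2_add_le hab hH1 hH2).trans ?_)
  rw [normL2_const_mul, normL2_const_mul, normL2_abs, normL2_abs, abs_of_pos (by positivity),
    abs_of_nonneg (by positivity)]
  have e1 := mul_le_mul_of_nonneg_left h1 (one_div_pos.2 hm).le
  have e2 := mul_le_mul_of_nonneg_left h2 (div_nonneg hκ0 (sq_nonneg amin))
  refine (add_le_add e1 e2).trans_eq ?_
  rw [hκ]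
  ring

/-- Here d is the error to be bounded and e a nearby function accessible by duality; write Lg for
the dual solution. Since the dual problem ignores a₀, the hypothesis only controls (g, e) + (a₀d,
Lg). Taking g = a₀d makes the extra term nonnegative and bounds ‖a₀d‖; taking g = d then treats
(a₀d, Ld) as a known perturbation. No smallness of h or of a₀ is required. -/
theorem normL2_le_of_dual {d e : ℝ → ℝ} {ε η : ℝ} (hd : MemL2 a b d) (he : MemL2 a b e)
    (hε : 0 ≤ ε) (hη : normL2 a b (fun x => d x - e x) ≤ η)
    (h : ∀ g : ℝ → ℝ, MemL2 a b g → |(∫ x in a..b, g x * e x)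
      + ∫ x in a..b, a₀ x * d x * prim a (dualDeriv a b a₂ g) x| ≤ ε * normL2 a b g) :
    normL2 a b d ≤ (1 + (b - a) ^ 2 / amin * A₀) * (ε + η) := by
  have hab := hc.lt.le
  have had := hc.memL2_a₀_mul hd
  have hde := hd.sub he
  have hsplit : ∀ g : ℝ → ℝ, MemL2 a b g →
      ∫ x in a..b, g x * d x ≤ (∫ x in a..b, g x * e x) + η * normL2 a b g := by
    intro g hg
    have h1 := integral_mul_sub hab hg hd he
    have h2 := (le_abs_self _).trans (abs_integral_mul_le hab hg hde)
    have h3 := mul_le_mul_of_nonneg_left hη (normL2_nonneg (a := a) (b := b) (f := g))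
    linarith
  set N := normL2 a b (fun x => a₀ x * d x) with hN
  have hN0 : 0 ≤ N := normL2_nonneg
  have hA0 := hc.A₀_nonneg
  -- The choice g = a₀d, where (a₀d, L(a₀d)) ≥ 0 can be dropped.
  have h1 : N ≤ A₀ * (ε + η) := by
    have e1 := (le_abs_self _).trans (h _ had)
    have e2 := hc.integral_mul_prim_dualDeriv_nonneg had
    have e3 := hsplit _ had
    have e4 := hc.normL2_a₀_mul_sq_le hd
    have e5 : N ^ 2 ≤ A₀ * ((ε + η) * N) := e4.trans (mul_le_mul_of_nonneg_left (by linarith) hA0)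
    rcases hN0.eq_or_lt with h0 | h0
    · rw [← h0]
      exact mul_nonneg hA0 (add_nonneg hε (normL2_nonneg.trans hη))
    · exact le_of_mul_le_mul_right (by linarith) h0
  -- The choice g = d, with ‖a₀d‖ now known.
  have h2 : normL2 a b d ^ 2 ≤ (1 + (b - a) ^ 2 / amin * A₀) * (ε + η) * normL2 a b d := by
    have e1 := (le_abs_self _).trans (h _ hd)
    have e3 := hsplit _ hd
    have e4 := (neg_le_abs _).trans (abs_integral_mul_le hab had
      (memL2_prim hab (hc.memL2_dualDeriv hd)))
    have e5 := mul_le_mul h1 (hc.normL2_prim_dualDeriv_le hd) normL2_nonneg (hN0.trans h1)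
    have e6 : normL2 a b d ^ 2 = ∫ x in a..b, d x * d x := by
      rw [normL2_sq hab]; simp only [pow_two]
    rw [← e6] at e3
    linarith
  rcases (normL2_nonneg (a := a) (b := b) (f := d)).eq_or_lt with h0 | h0
  · rw [← h0]
    exact mul_nonneg (add_nonneg zero_le_one
      (mul_nonneg (div_nonneg (sq_nonneg _) hc.amin_pos.le) hA0))
      (add_nonneg hε (normL2_nonneg.trans hη))
  · rw [pow_two] at h2
    exact le_of_mul_le_mul_right h2 h0

end CoefficientBounds

/-! ### The error estimate -/

namespace CoefficientBounds

variable {a b amin A₂ D₂ A₀ : ℝ} {a₂ a₂' a₀ : ℝ → ℝ}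

/-- The constant of the estimate of `u' - d_w u_h`. -/
def energyConst (a b amin A₂ A₀ S : ℝ) : ℝ := 1 + (A₂ + S + 3 * (b - a) ^ 2 * A₀) / amin

variable (hc : CoefficientBounds a b amin A₂ D₂ A₀ a₂ a₂' a₀)
include hc

theorem energyConst_nonneg {S : ℝ} (hS : 0 ≤ S) : 0 ≤ energyConst a b amin A₂ A₀ S := by
  have h1 := hc.A₂_nonneg
  have h2 := hc.A₀_nonneg
  have h3 := hc.amin_pos
  unfold energyConst
  positivity

variable {n : ℕ} {T : Partition a b} {u' : ℝ → ℝ} {p U₀ y q : Fin (T.n + 1) → Polynomial ℝ}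
  {M S : ℝ}

/-- Energy estimate with k = n+1: p is the discrete weak derivative, U₀ the interior part, `hE` the
error equation. Coercivity of a₂ is applied to ψ = q-p. -/
theorem normL2_deriv_error_le (hM : 0 ≤ M) (hS : 0 ≤ S) (hu' : MemL2 a b u')
    (hq : ∀ i, (q i).natDegree ≤ n + 2) (hqu : normL2 a b (fun x => u' x - T.pw q x)
      ≤ T.meshSize ^ (n + 1) * M)
    (hy : ∀ i, (y i).natDegree ≤ n + 1) (hyu : normL2 a b (fun x => prim a u' x - T.pw y x)
      ≤ T.meshSize ^ (n + 2) * M)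
    (hp : ∀ i, (p i).natDegree ≤ n + 2) (hU : T.IsProj (n + 1) (prim a (T.pw p)) U₀)
    (hE : ∀ ψ : Fin (T.n + 1) → Polynomial ℝ, (∀ i, (ψ i).natDegree ≤ n + 2) →
      ∃ z : Fin (T.n + 1) → Polynomial ℝ, T.IsProj (n + 1) (prim a (T.pw ψ)) z ∧
        |(∫ x in a..b, a₂ x * (u' x - T.pw p x) * T.pw ψ x)
          + ∫ x in a..b, a₀ x * (prim a u' x - T.pw U₀ x) * T.pw z x|
          ≤ T.meshSize ^ n * (S * M) * normL2 a b (fun x => prim a (T.pw ψ) x - T.pw z x)) :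
    normL2 a b (fun x => u' x - T.pw p x)
      ≤ energyConst a b amin A₂ A₀ S * (T.meshSize ^ (n + 1) * M) := by
  have hab := hc.lt.le
  have hL : 0 ≤ b - a := sub_nonneg.2 hab
  have hh := T.meshSize_pos.le
  have hm := hc.amin_pos
  have hA2 := hc.A₂_nonneg
  have hA0 := hc.A₀_nonneg
  set h := T.meshSize
  have hpL := T.memL2_pw p
  have hqL := T.memL2_pw q
  have hUL := T.memL2_pw U₀
  have huL := memL2_prim hab hu'
  set ψ : Fin (T.n + 1) → Polynomial ℝ := fun i => q i - p i
  have hψeq : ∀ x, T.pw ψ x = T.pw q x - T.pw p x := T.pw_sub q p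
  have hψL := T.memL2_pw ψ
  obtain ⟨z, hz, hzE⟩ := hE ψ fun i =>
    (Polynomial.natDegree_sub_le _ _).trans (max_le (hq i) (hp i))
  have hzL := T.memL2_pw z
  set θ := normL2 a b (T.pw ψ)
  have hθ0 : 0 ≤ θ := normL2_nonneg
  have hhn : h ^ (n + 1) = h ^ n * h := pow_succ h n
  -- the consistency term
  have b1 : normL2 a b (fun x => prim a (T.pw ψ) x - T.pw z x) ≤ h * θ :=
    hz.normL2_sub_le_meshSize (memL2_prim hab hψL) hψL fun x _ => by simp [prim]
  have b2 := hzE.trans (mul_le_mul_of_nonneg_left b1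
    (mul_nonneg (pow_nonneg hh n) (mul_nonneg hS hM)))
  have b3 : normL2 a b (T.pw z) ≤ (b - a) * θ :=
    (hz.normL2_le (memL2_prim hab hψL)).trans (normL2_prim_le hab hψL)
  -- the approximation of the primitive
  have b4 : normL2 a b (fun x => prim a u' x - prim a (T.pw q) x) ≤ (b - a) * (h ^ (n + 1) * M) := by
    rw [← normL2_congr hab (ae_Ioo_of_forall_Icc fun x hx => prim_sub hu' hqL hx)]
    exact (normL2_prim_le hab (hu'.sub hqL)).trans (mul_le_mul_of_nonneg_left hqu hL)
  have hpq : ∀ x ∈ Icc a b, prim a (T.pw ψ) x = prim a (T.pw q) x - prim a (T.pw p) x := by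
    intro x hx
    rw [← prim_sub hqL hpL hx]
    congr 1
    exact funext hψeq
  have hPq := memL2_prim hab hqL
  have hadd : ∀ x, T.pw (fun i => U₀ i - -z i) x = T.pw U₀ x + T.pw z x := by
    intro x
    have := T.pw_sub (fun i => U₀ i - -z i) z x
    simp only [sub_neg_eq_add, add_sub_cancel_right] at this ⊢
    linarith
  -- By linearity U₀ + z projects the primitive of p + ψ = q. Hence u - U₀ is z plus a quantity that
  -- is small by approximation alone. The double negation allows reuse of `pw_sub`.
  have hprojq : T.IsProj (n + 1) (prim a (T.pw q)) (fun i => U₀ i - -z i) := by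
    refine ⟨fun i => (Polynomial.natDegree_sub_le _ _).trans
      (max_le (hU.1 i) (by rw [Polynomial.natDegree_neg]; exact hz.1 i)), fun r hr => ?_⟩
    have e1 := hU.2 r hr
    have e2 := hz.2 r hr
    have e3 := intervalIntegral.integral_add
      (((memL2_prim hab hpL).sub hUL).intervalIntegrable_mul hab (T.memL2_pw r))
      (((memL2_prim hab hψL).sub hzL).intervalIntegrable_mul hab (T.memL2_pw r))
    rw [e1, e2, add_zero] at e3
    rw [← e3]
    refine integral_congr_Ioo hab fun x hx => ?_
    rw [hpq x ⟨hx.1.le, hx.2.le⟩, hadd]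
    ring
  have b5 := hprojq.normL2_sub_le hPq hy
  have b6 : normL2 a b (fun x => prim a (T.pw q) x - T.pw y x)
      ≤ (b - a) * (h ^ (n + 1) * M) + h ^ (n + 2) * M := by
    have e1 := normL2_sub_le hab (huL.sub (T.memL2_pw y)) (huL.sub hPq)
    refine le_trans (le_of_eq ?_) (e1.trans ((add_le_add hyu b4).trans_eq (add_comm _ _)))
    congr 1
    funext x
    ring
  -- The factor 3 counts ‖u-Pq‖ twice and the approximation error of u once, the latter with one
  -- power of h replaced by b-a.
  have hnp : normL2 a b (fun x => prim a u' x - T.pw U₀ x - T.pw z x)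
      ≤ 3 * (b - a) * (h ^ (n + 1) * M) := by
    have e1 := normL2_add_le hab (huL.sub hPq) (hPq.sub (T.memL2_pw fun i => U₀ i - -z i))
    have e2 : h ^ (n + 2) * M ≤ (b - a) * (h ^ (n + 1) * M) := by
      rw [pow_succ' h (n + 1), mul_assoc]
      exact mul_le_mul_of_nonneg_right T.meshSize_le (mul_nonneg (pow_nonneg hh _) hM)
    refine le_trans (le_of_eq ?_) (e1.trans (by linarith))
    congr 1
    funext x
    rw [hadd]
    ring
  have hdL := huL.sub hUL
  have had := hc.memL2_a₀_mul hdL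
  have hrL := hdL.sub hzL
  -- the zeroth order term
  have c1 : -(∫ x in a..b, a₀ x * (prim a u' x - T.pw U₀ x) * T.pw z x)
      ≤ A₀ * (3 * (b - a) * (h ^ (n + 1) * M)) * ((b - a) * θ) := by
    have e1 := (neg_le_abs _).trans (abs_integral_mul_le hab (hc.memL2_a₀_mul hrL) hzL)
    have e2 := (hc.normL2_a₀_mul_le hrL).trans (mul_le_mul_of_nonneg_left hnp hA0)
    have e3 := mul_le_mul e2 b3 normL2_nonneg (normL2_nonneg.trans e2)
    -- The part (a₀z, z) has the favourable sign and is discarded.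
    have e4 := hc.integral_a₀_mul_nonneg (T.pw z)
    have e5 := integral_sub_mul hab had (hc.memL2_a₀_mul hzL) hzL
    simp only [← mul_sub] at e5
    linarith
  -- the leading term
  have c2 : ∫ x in a..b, a₂ x * (T.pw q x - u' x) * T.pw ψ x ≤ A₂ * (h ^ (n + 1) * M) * θ := by
    have e1 := (le_abs_self _).trans (abs_integral_mul_le hab (hc.memL2_a₂_mul (hqL.sub hu')) hψL)
    have e2 : normL2 a b (fun x => T.pw q x - u' x) ≤ h ^ (n + 1) * M := by
      rw [← normL2_neg]
      simpa only [neg_sub] using hqu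
    exact e1.trans (mul_le_mul_of_nonneg_right ((hc.normL2_a₂_mul_le (hqL.sub hu')).trans
      (mul_le_mul_of_nonneg_left e2 hA2)) hθ0)
  have c3 : ∫ x in a..b, a₂ x * T.pw ψ x * T.pw ψ x
      = (∫ x in a..b, a₂ x * (T.pw q x - u' x) * T.pw ψ x)
        + ∫ x in a..b, a₂ x * (u' x - T.pw p x) * T.pw ψ x := by
    rw [← intervalIntegral.integral_add
      ((hc.memL2_a₂_mul (hqL.sub hu')).intervalIntegrable_mul hab hψL)
      ((hc.memL2_a₂_mul (hu'.sub hpL)).intervalIntegrable_mul hab hψL)]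
    refine intervalIntegral.integral_congr fun x _ => ?_
    simp only [hψeq]
    ring
  have c4 := hc.amin_mul_normL2_sq_le hψL
  have c5 : amin * θ * θ ≤ (A₂ + S + 3 * (b - a) ^ 2 * A₀) * (h ^ (n + 1) * M) * θ := by
    have := le_of_abs_le b2
    rw [hhn] at c1 c2 ⊢
    calc amin * θ * θ = amin * θ ^ 2 := by ring
      _ ≤ A₂ * (h ^ n * h * M) * θ + h ^ n * (S * M) * (h * θ)
          + A₀ * (3 * (b - a) * (h ^ n * h * M)) * ((b - a) * θ) := by linarith
      _ = _ := by ring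
  have hX : 0 ≤ h ^ (n + 1) * M := mul_nonneg (pow_nonneg hh _) hM
  have c6 : θ ≤ (A₂ + S + 3 * (b - a) ^ 2 * A₀) / amin * (h ^ (n + 1) * M) := by
    rcases hθ0.eq_or_lt with h0 | h0
    · rw [← h0]; positivity
    · rw [div_mul_eq_mul_div, le_div_iff₀ hm]
      linarith [le_of_mul_le_mul_right c5 h0]
  have c7 := normL2_add_le hab (hu'.sub hqL) hψL
  calc _ = normL2 a b (fun x => u' x - T.pw q x + T.pw ψ x) := by
        congr 1
        funext x
        rw [hψeq]
        ring
    _ ≤ _ := c7.trans (add_le_add hqu c6)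
    _ = _ := by unfold energyConst; ring

/-- The constant of the final estimate. -/
def errorConst (a b amin A₂ D₂ A₀ K : ℝ) : ℝ :=
  (1 + (b - a) ^ 2 / amin * A₀) *
    ((A₂ * K + A₀ * ((b - a) * (1 + 2 * K)) * (b - a)) *
      (1 / amin + Real.sqrt (b - a) * D₂ / amin ^ 2) + (1 + K))

/-- Duality with d = u-U₀ and e = u-Pp, the primitive of e' = u'-p. They differ by Pp-U₀, a
projection error of order h^{k+1}; for e, the dual derivative may be replaced by its error from
piecewise constants. -/
theorem normL2_error_le (hM : 0 ≤ M) {K : ℝ} (hK : 0 ≤ K) (hu' : MemL2 a b u')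
    (hy : ∀ i, (y i).natDegree ≤ n + 1) (hyu : normL2 a b (fun x => prim a u' x - T.pw y x)
      ≤ T.meshSize ^ (n + 2) * M)
    (hU : T.IsProj (n + 1) (prim a (T.pw p)) U₀)
    (hE : ∀ ψ : Fin (T.n + 1) → Polynomial ℝ, (∀ i, (ψ i).natDegree ≤ n + 2) →
      ∃ z : Fin (T.n + 1) → Polynomial ℝ, T.IsProj (n + 1) (prim a (T.pw ψ)) z ∧
        |(∫ x in a..b, a₂ x * (u' x - T.pw p x) * T.pw ψ x)
          + ∫ x in a..b, a₀ x * (prim a u' x - T.pw U₀ x) * T.pw z x|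
          ≤ T.meshSize ^ n * (S * M) * normL2 a b (fun x => prim a (T.pw ψ) x - T.pw z x))
    (hup : normL2 a b (fun x => u' x - T.pw p x) ≤ K * (T.meshSize ^ (n + 1) * M)) :
    normL2 a b (fun x => prim a u' x - T.pw U₀ x)
      ≤ errorConst a b amin A₂ D₂ A₀ K * (T.meshSize ^ (n + 2) * M) := by
  have hab := hc.lt.le
  have hL : 0 ≤ b - a := sub_nonneg.2 hab
  have hh := T.meshSize_pos.le
  have hm := hc.amin_pos
  have hA2 := hc.A₂_nonneg
  have hA0 := hc.A₀_nonneg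
  have hD2 := hc.D₂_nonneg
  set h := T.meshSize
  have hpL := T.memL2_pw p
  have hUL := T.memL2_pw U₀
  have huL := memL2_prim hab hu'
  have hPp := memL2_prim hab hpL
  have hdL := huL.sub hUL
  set X := h ^ (n + 1) * M with hX
  have hX0 : 0 ≤ X := mul_nonneg (pow_nonneg hh _) hM
  have hhX : h ^ (n + 2) * M = h * X := by rw [hX, pow_succ' h (n + 1), mul_assoc]
  rw [hhX] at hyu ⊢
  set e' : ℝ → ℝ := fun x => u' x - T.pw p x
  have he'L : MemL2 a b e' := hu'.sub hpL
  have heL := memL2_prim hab he'L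
  have hee : ∀ x ∈ Icc a b, prim a e' x = prim a u' x - prim a (T.pw p) x := fun x hx =>
    prim_sub hu' hpL hx
  -- the projection error of the discrete solution
  have hρ : normL2 a b (fun x => prim a (T.pw p) x - T.pw U₀ x) ≤ (1 + K) * (h * X) := by
    -- Competitor for Pp = u - e: approximate u by y and e by its left nodal values. The second
    -- error is at most h‖e'‖, which the energy estimate makes of order h^{k+1}.
    have e1 := hU.normL2_sub_le hPp
      (y := fun i => y i - Polynomial.C (prim a e' (T.lo i)))
      fun i => (Polynomial.natDegree_sub_le _ _).trans (max_le (hy i) (by simp))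
    have e2 := T.normL2_sub_pw_const_le heL he'L fun x _ => by simp [prim]
    have e3 := normL2_sub_le hab (huL.sub (T.memL2_pw y)) (heL.sub
      (T.memL2_pw fun i => Polynomial.C (prim a e' (T.lo i))))
    have e4 := e2.trans (mul_le_mul_of_nonneg_left hup hh)
    refine e1.trans (le_trans (le_of_eq ?_) (e3.trans ((add_le_add hyu e4).trans_eq (by ring))))
    refine normL2_congr hab (ae_Ioo_of_forall_Icc fun x hx => ?_)
    simp only [T.pw_sub]
    rw [hee x hx]
    ring
  have hde : normL2 a b (fun x => prim a u' x - T.pw U₀ x - prim a e' x) ≤ (1 + K) * (h * X) := by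
    rw [← normL2_congr hab (ae_Ioo_of_forall_Icc (P := fun x => prim a (T.pw p) x - T.pw U₀ x
      = prim a u' x - T.pw U₀ x - prim a e' x) fun x hx => by rw [hee x hx]; ring)]
    exact hρ
  -- a first bound of the error
  have hd : normL2 a b (fun x => prim a u' x - T.pw U₀ x) ≤ (b - a) * (1 + 2 * K) * X := by
    have e1 := normL2_add_le hab (hdL.sub heL) heL
    simp only [sub_add_cancel] at e1
    have e2 := (normL2_prim_le hab he'L).trans (mul_le_mul_of_nonneg_left hup hL)
    have e3 : (1 + K) * (h * X) ≤ (1 + K) * ((b - a) * X) :=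
      mul_le_mul_of_nonneg_left (mul_le_mul_of_nonneg_right T.meshSize_le hX0) (by linarith)
    refine e1.trans ((add_le_add (hde.trans e3) e2).trans_eq (by ring))
  set c₄ := 1 / amin + Real.sqrt (b - a) * D₂ / amin ^ 2 with hc₄
  have hc₄0 : 0 ≤ c₄ := by positivity
  set ε := (A₂ * K + A₀ * ((b - a) * (1 + 2 * K)) * (b - a)) * c₄ * (h * X) with hε
  have hε0 : 0 ≤ ε := by positivity
  have key := hc.normL2_le_of_dual hdL heL hε0 hde fun g hg => by
    obtain ⟨c, hcc⟩ := hc.exists_pw_const_dualDeriv T hg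
    obtain ⟨z, hz, hzE⟩ := hE (fun i => Polynomial.C (c i)) fun i => by simp
    -- For a piecewise constant test the consistency bound is zero, so the error equation holds
    -- exactly.
    rw [hz.normL2_sub_eq_zero (by omega), mul_zero] at hzE
    have hzE := abs_nonpos_iff.1 hzE
    set ψ := T.pw fun i => Polynomial.C (c i) with hψ
    have hψL : MemL2 a b ψ := T.memL2_pw _
    have hzL := T.memL2_pw z
    have hPψ := memL2_prim hab hψL
    have hw' := hc.memL2_dualDeriv hg
    have hw := memL2_prim hab hw'
    set w' := dualDeriv a b a₂ g
    have had := hc.memL2_a₀_mul hdL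
    have hae := hc.memL2_a₂_mul he'L
    have e1 : ∫ x in a..b, a₀ x * (prim a u' x - T.pw U₀ x) * (prim a ψ x - T.pw z x) = 0 := by
      have := abs_integral_mul_le hab had (hPψ.sub hzL)
      rw [hz.normL2_sub_eq_zero (by omega), mul_zero] at this
      exact abs_nonpos_iff.1 this
    rw [integral_mul_sub hab had hPψ hzL] at e1
    have e2 := integral_mul_sub hab had hw hPψ
    have e3 := integral_mul_sub hab hae hw' hψL
    rw [hc.integral_mul_prim_eq hg he'L]
    have e4 : (∫ x in a..b, a₂ x * e' x * w' x)
        + (∫ x in a..b, a₀ x * (prim a u' x - T.pw U₀ x) * prim a w' x)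
        = (∫ x in a..b, a₂ x * e' x * (w' x - ψ x))
        + ∫ x in a..b, a₀ x * (prim a u' x - T.pw U₀ x) * (prim a w' x - prim a ψ x) := by
      linarith
    rw [e4]
    have f1 := abs_integral_mul_le hab hae (hw'.sub hψL)
    have f2 := abs_integral_mul_le hab had (hw.sub hPψ)
    have f3 : normL2 a b (fun x => prim a w' x - prim a ψ x)
        ≤ (b - a) * (c₄ * h * normL2 a b g) := by
      rw [← normL2_congr hab (ae_Ioo_of_forall_Icc fun x hx => prim_sub hw' hψL hx)]
      exact (normL2_prim_le hab (hw'.sub hψL)).trans (mul_le_mul_of_nonneg_left hcc hL)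
    have g1 := mul_le_mul ((hc.normL2_a₂_mul_le he'L).trans (mul_le_mul_of_nonneg_left hup hA2))
      hcc normL2_nonneg (by positivity)
    have g2 := mul_le_mul ((hc.normL2_a₀_mul_le hdL).trans (mul_le_mul_of_nonneg_left hd hA0))
      f3 normL2_nonneg (by positivity)
    refine (abs_add_le _ _).trans ((add_le_add (f1.trans g1) (f2.trans g2)).trans_eq ?_)
    rw [hε]
    ring
  refine key.trans_eq ?_
  rw [hε, errorConst, ← hc₄]
  ring

theorem errorConst_nonneg {K : ℝ} (hK : 0 ≤ K) : 0 ≤ errorConst a b amin A₂ D₂ A₀ K := by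
  have h1 := hc.A₂_nonneg
  have h2 := hc.A₀_nonneg
  have h3 := hc.amin_pos
  have h4 := hc.D₂_nonneg
  have h5 := sub_nonneg.2 hc.lt.le
  unfold errorConst
  positivity

/-- The error equation, with the consistency error bounded by the smoothness of the flux. -/
theorem exists_error_equation {σ' f a₂₀ : ℝ → ℝ} {uh : WeakFunction T (n + 1)}
    (hae : a₂ =ᵐ[volume.restrict (Ioo a b)] a₂₀) (hf : MemL2 a b f) (hu' : MemL2 a b u')
    (hsol : IsWeakFESolution T (n + 1) (n + 1 + 1) a₂₀ a₀ f uh)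
    (hσ : SobolevBound a b n (S * M) σ')
    (hσp : ∀ x ∈ Icc a b, a₂ x * u' x = a₂ a * u' a + prim a σ' x) (hσb : a₂ b * u' b = 0)
    (hσe : σ' =ᵐ[volume.restrict (Ioo a b)] fun x => a₀ x * prim a u' x - f x)
    (ψ : Fin (T.n + 1) → Polynomial ℝ) (hψ : ∀ i, (ψ i).natDegree ≤ n + 2) :
    ∃ z : Fin (T.n + 1) → Polynomial ℝ, T.IsProj (n + 1) (prim a (T.pw ψ)) z ∧
      |(∫ x in a..b, a₂ x * (u' x - T.pw (uh.dw (n + 2)) x) * T.pw ψ x)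
        + ∫ x in a..b, a₀ x * (prim a u' x - T.pw uh.interior x) * T.pw z x|
        ≤ T.meshSize ^ n * (S * M) * normL2 a b (fun x => prim a (T.pw ψ) x - T.pw z x) := by
  have hab := hc.lt.le
  have haeL : ∀ p : Fin (T.n + 1) → Polynomial ℝ, MemL2 a b (fun x => a₂₀ x * T.pw p x) :=
    fun p => memL2_congr (hae.mono fun x hx => by simp only [hx])
      (hc.memL2_a₂_mul (T.memL2_pw p))
  obtain ⟨z, hz, heq⟩ := hsol.exists_test haeL hψ
  refine ⟨z, hz, ?_⟩
  -- The degree of s is below n, hence s is orthogonal to Pψ - z and can be subtracted from σ'; for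
  -- n = 0 it is zero.
  obtain ⟨s, hs, hsn⟩ := T.exists_pw_approx hσ
  have hs' : ∀ i, (s i).natDegree ≤ n + 1 := fun i => by
    rw [Partition.natDegree_le_iff_degree_lt]
    exact (hs i).trans (by exact_mod_cast (by omega : n < n + 1 + 1))
  have hψL := T.memL2_pw ψ
  have hzL := T.memL2_pw z
  have hsL := T.memL2_pw s
  have hσL := hσ.memL2
  have hPψ := memL2_prim hab hψL
  have huL := memL2_prim hab hu'
  have hpL := T.memL2_pw (uh.dw (n + 2))
  have hUL := T.memL2_pw uh.interior
  have e1 : ∫ x in a..b, a₂₀ x * T.pw (uh.dw (n + 1 + 1)) x * T.pw ψ x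
      = ∫ x in a..b, a₂ x * T.pw (uh.dw (n + 2)) x * T.pw ψ x :=
    integral_congr_ae_Ioo hab (hae.mono fun x hx => by simp only [hx])
  have e2 := integral_primitive_mul hab (F := fun x => a₂ x * u' x) (G := prim a (T.pw ψ))
    (hσL.intervalIntegrable hab) (hψL.intervalIntegrable hab) hσp (fun x _ => by simp [prim])
  have hPa : prim a (T.pw ψ) a = 0 := intervalIntegral.integral_same
  simp only [hσb, hPa, zero_mul, mul_zero, sub_zero] at e2
  rw [intervalIntegral.integral_add (hσL.intervalIntegrable_mul hab hPψ)
    ((hc.memL2_a₂_mul hu').intervalIntegrable_mul hab hψL)] at e2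
  have e3 : ∫ x in a..b, σ' x * T.pw z x
      = (∫ x in a..b, a₀ x * prim a u' x * T.pw z x) - ∫ x in a..b, f x * T.pw z x := by
    rw [← integral_sub_mul hab (hc.memL2_a₀_mul huL) hf hzL]
    exact integral_congr_ae_Ioo hab (hσe.mono fun x hx => by simp only [hx])
  have e4 := integral_sub_mul hab (hc.memL2_a₂_mul hu') (hc.memL2_a₂_mul hpL) hψL
  have e5 := integral_sub_mul hab (hc.memL2_a₀_mul huL) (hc.memL2_a₀_mul hUL) hzL
  simp only [← mul_sub] at e4 e5
  have e6 := hz.2 s hs'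
  have e7 := integral_sub_mul hab hσL hsL (hPψ.sub hzL)
  have e8 := integral_mul_sub hab hσL hPψ hzL
  have e9 : ∫ x in a..b, T.pw s x * (prim a (T.pw ψ) x - T.pw z x) = 0 := by
    rw [← e6]
    exact intervalIntegral.integral_congr fun x _ => mul_comm _ _
  rw [e1] at heq
  change _ + (∫ x in a..b, a₀ x * T.pw uh.interior x * T.pw z x) = _ at heq
  have e10 : (∫ x in a..b, a₂ x * (u' x - T.pw (uh.dw (n + 2)) x) * T.pw ψ x)
      + (∫ x in a..b, a₀ x * (prim a u' x - T.pw uh.interior x) * T.pw z x)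
      = -∫ x in a..b, (σ' x - T.pw s x) * (prim a (T.pw ψ) x - T.pw z x) := by
    linarith
  rw [e10, abs_neg]
  exact (abs_integral_mul_le hab (hσL.sub hsL) (hPψ.sub hzL)).trans
    (mul_le_mul_of_nonneg_right hsn normL2_nonneg)

end CoefficientBounds

/-! ### From the weak hypotheses to the estimate -/

/-- The coefficient a₂ is needed pointwise and is replaced by its continuous representative; a₀
enters only under integrals, so almost everywhere bounds suffice and it stays unchanged. -/
theorem exists_coefficientBounds {a b : ℝ} (hab : a < b) {n : ℕ} {a₂ a₀ : ℝ → ℝ} {amin : ℝ}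
    (hamin : 0 < amin) (ha₂_ge : ∀ᵐ x ∂(volume.restrict (Ioo a b)), amin ≤ a₂ x)
    (ha₀_nonneg : ∀ᵐ x ∂(volume.restrict (Ioo a b)), 0 ≤ a₀ x)
    (ha₂ : MemH (n + 1) a b a₂) (ha₀ : MemH 1 a b a₀) :
    ∃ (α α' : ℝ → ℝ) (A₂ D₂ A₀ : ℝ), α =ᵐ[volume.restrict (Ioo a b)] a₂ ∧
      SobolevBound a b (n + 1) D₂ α ∧ CoefficientBounds a b amin A₂ D₂ A₀ α α' a₀ := by
  obtain ⟨α, hα, hαb⟩ := ha₂.exists_sobolevBound hab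
  obtain ⟨γ, hγ, hγb⟩ := ha₀.exists_sobolevBound hab
  obtain ⟨-, α', hα', hα'b⟩ := id hαb
  refine ⟨α, α', SobolevBound.supConst a b * normH (n + 1) a b a₂, normH (n + 1) a b a₂,
    SobolevBound.supConst a b * normH 1 a b a₀, hα, hαb, hab, hamin, fun x hx => ?_,
    fun x hx => ?_, hα', hα'b.memL2, hα'b.norm_le, ?_, ha₀_nonneg, ?_⟩
  · refine ae_le_imp_le_of_continuousOn hab (hαb.continuousOn hab.le) ?_ hx
    filter_upwards [hα, ha₂_ge] with y h1 h2
    rwa [h1]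
  · exact (le_abs_self _).trans (hαb.abs_le hab hx)
  · exact hγb.memL2.1.congr hγ
  · filter_upwards [hγ, ae_Ioo_of_forall_Icc fun x hx => hγb.abs_le hab hx] with x h1 h2
    rw [← h1]
    exact (le_abs_self _).trans h2

theorem normL2_sub_interiorFun_le {a b amin A₂ D₂ A₀ S : ℝ} {a₂ α α' a₀ : ℝ → ℝ} {n : ℕ}
    (hc : CoefficientBounds a b amin A₂ D₂ A₀ α α' a₀)
    (hα : α =ᵐ[volume.restrict (Ioo a b)] a₂) (hαb : SobolevBound a b (n + 1) D₂ α)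
    (hS : 0 ≤ S) (hmul : ∀ {A B : ℝ} {f g : ℝ → ℝ}, SobolevBound a b (n + 1) A f →
      SobolevBound a b (n + 1) B g → SobolevBound a b (n + 1) (S * (A * B)) (fun x => f x * g x))
    {f u : ℝ → ℝ} (hf : MemL2 a b f) (hu : MemH (n + 2) a b u)
    (hbvp : IsBVPSolution a b a₂ a₀ f u) (T : Partition a b) (uh : WeakFunction T (n + 1))
    (huh : IsWeakFESolution T (n + 1) (n + 1 + 1) a₂ a₀ f uh) :
    normL2 a b (fun x => u x - uh.interiorFun x)
      ≤ CoefficientBounds.errorConst a b amin A₂ D₂ A₀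
          (CoefficientBounds.energyConst a b amin A₂ A₀ (S * D₂))
        * (T.meshSize ^ (n + 2) * normH (n + 2) a b u) := by
  have hab := hc.lt
  obtain ⟨u', hu', hσw, hua, hub⟩ := hbvp
  obtain ⟨v, v', hv, hv', hvp, hvb, hv'b⟩ := hu.exists_sobolevBound_deriv hab hu'
  set M := normH (n + 2) a b u
  have hM : 0 ≤ M := hvb.nonneg
  have hva : v a = 0 :=
    hua.eq_of_continuousOn hab (hvb.continuousOn hab.le) hv ⟨le_rfl, hab.le⟩
  have hv'c := hv'b.continuousOn hab.le
  have hv'end : v' b = 0 := hub.eq_of_continuousOn hab hv'c hv' ⟨hab.le, le_rfl⟩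
  obtain rfl : v = prim a v' := funext fun x => by rw [hvp x, hva, zero_add]
  obtain ⟨-, σ', hσp, hσb⟩ := hmul hαb hv'b
  have huL := hvb.memL2
  -- the derivative of the flux
  have hrhs : (fun x => a₀ x * u x - f x)
      =ᵐ[volume.restrict (Ioo a b)] fun x => a₀ x * prim a v' x - f x :=
    hv.mono fun x hx => by simp only [hx]
  have hrL : MemL2 a b (fun x => a₀ x * prim a v' x - f x) := (hc.memL2_a₀_mul huL).sub hf
  have hflux : (fun x => a₂ x * u' x) =ᵐ[volume.restrict (Ioo a b)] fun x => α x * v' x := by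
    filter_upwards [hα, hv'] with x h1 h2
    rw [h1, h2]
  have hσc : ContinuousOn (fun x => α x * v' x) (Icc a b) := hc.continuousOn.mul hv'c
  obtain ⟨c, hcc⟩ := hσw.exists_ae_eq_prim hab
    (memL2_congr hflux.symm (memL2_of_continuousOn hσc)).integrableOn
    (memL2_congr hrhs.symm hrL).integrableOn
  -- The product of representatives and the weak flux equation give two primitives of the same
  -- continuous function, so their integrands agree almost everywhere.
  have hσe : σ' =ᵐ[volume.restrict (Ioo a b)] fun x => a₀ x * prim a v' x - f x := by
    refine ae_eq_of_prim_eq hab.le (hσb.memL2.intervalIntegrable hab.le)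
      (hrL.intervalIntegrable hab.le) (α a * v' a) c fun x hx => ?_
    have hx' : x ∈ Icc a b := ⟨hx.1.le, hx.2.le⟩
    have hval : HasValueAt a b (fun x => a₂ x * u' x) x
        (c + prim a (fun x => a₀ x * prim a v' x - f x) x) := by
      refine ⟨fun x => c + prim a (fun x => a₀ x * prim a v' x - f x) x,
        continuousOn_const.add (continuousOn_prim hab.le (hrL.intervalIntegrable hab.le)), ?_, rfl⟩
      refine EventuallyEq.trans (ae_Ioo_of_forall_Icc fun y hy => ?_) hcc.symm
      rw [prim_congr hrhs hy]
    rw [← hσp x hx']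
    exact hval.eq_of_continuousOn hab hσc hflux.symm hx'
  -- the approximation of `u` and `u'`
  obtain ⟨q, hq, hqn⟩ := T.exists_pw_approx hv'b
  obtain ⟨y, hy, hyn⟩ := T.exists_pw_approx hvb
  have hq' : ∀ i, (q i).natDegree ≤ n + 2 := fun i =>
    (Partition.natDegree_le_iff_degree_lt.2 (hq i)).trans (by omega)
  have hy' : ∀ i, (y i).natDegree ≤ n + 1 := fun i =>
    Partition.natDegree_le_iff_degree_lt.2 (hy i)
  have hU := WeakFunction.isProj_interior huh.1
  have hS' : 0 ≤ S * D₂ := mul_nonneg hS hc.D₂_nonneg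
  have hE := hc.exists_error_equation (S := S * D₂) (M := M) hα hf hv'b.memL2 huh
    (hσb.mono (by rw [mul_assoc])) hσp (by rw [hv'end, mul_zero]) hσe
  have hK := hc.energyConst_nonneg hS'
  have hen := hc.normL2_deriv_error_le hM hS' hv'b.memL2 hq' hqn hy' hyn
    (fun i => (uh.isDiscreteWeakDeriv_dw (n + 2) i).1) hU hE
  have hfin := hc.normL2_error_le hM hK hv'b.memL2 hy' hyn hU hE hen
  refine le_trans (le_of_eq (normL2_congr hab.le ?_)) hfin
  filter_upwards [hv] with x hx
  rw [hx]
  rfl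

end WeakFEM
end

theorem mainTheorem6 (a b : ℝ) (hab : a < b) (k : ℕ) (hk : 1 ≤ k)
    (a₂ a₀ : ℝ → ℝ) (amin : ℝ) (hamin : 0 < amin)
    (ha₂_ge : ∀ᵐ x ∂(MeasureTheory.volume.restrict (Set.Ioo a b)), amin ≤ a₂ x)
    (ha₀_nonneg : ∀ᵐ x ∂(MeasureTheory.volume.restrict (Set.Ioo a b)), 0 ≤ a₀ x)
    (ha₂ : WeakFEM.MemH k a b a₂) (ha₀ : WeakFEM.MemH 1 a b a₀) :
    ∃ C : ℝ, 0 < C ∧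
      ∀ (f u : ℝ → ℝ), WeakFEM.MemL2 a b f → WeakFEM.MemH (k + 1) a b u →
        WeakFEM.IsBVPSolution a b a₂ a₀ f u →
        ∀ (T : WeakFEM.Partition a b) (uh : WeakFEM.WeakFunction T k),
          WeakFEM.IsWeakFESolution T k (k + 1) a₂ a₀ f uh →
          WeakFEM.normL2 a b (fun x => u x - uh.interiorFun x)
            ≤ C * T.meshSize ^ (k + 1) * WeakFEM.normH (k + 1) a b u := by
  obtain ⟨n, rfl⟩ : ∃ n, k = n + 1 := ⟨k - 1, by omega⟩
  obtain ⟨α, α', A₂, D₂, A₀, hα, hαb, hc⟩ :=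
    WeakFEM.exists_coefficientBounds hab hamin ha₂_ge ha₀_nonneg ha₂ ha₀
  obtain ⟨S, hS, hmul⟩ := WeakFEM.SobolevBound.exists_mul_succ hab n
  have hK := hc.energyConst_nonneg (mul_nonneg hS hc.D₂_nonneg)
  -- The added 1 only ensures a strictly positive constant.
  refine ⟨WeakFEM.CoefficientBounds.errorConst a b amin A₂ D₂ A₀
    (WeakFEM.CoefficientBounds.energyConst a b amin A₂ A₀ (S * D₂)) + 1,
    add_pos_of_nonneg_of_pos (hc.errorConst_nonneg hK) one_pos,
    fun f u hf hu hbvp T uh huh => ?_⟩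
  refine (WeakFEM.normL2_sub_interiorFun_le hc hα hαb hS hmul hf hu hbvp T uh huh).trans ?_
  rw [mul_assoc]
  exact mul_le_mul_of_nonneg_right (le_add_of_nonneg_right zero_le_one)
    (mul_nonneg (pow_nonneg T.meshSize_pos.le _) (Real.sqrt_nonneg _))
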